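/- \textbf{Definitions.} Let $n,k$ be integers with $1<k\le n$. A \emph{parking function} of length $n$ is an $n$-tuple $(a_1,\dots,a_n)$ of positive integers which has a weakly increasing rearrangement whose $i$th entry is at most $i$ for every $i\in\{1,\dots,n\}$. Let $\mathrm{PF}_{n,k}$ be the set of parking functions of length $n$ in which $k$ does not occur but each of $k+1,\dots,n$ does. Let $\mathrm{NC}_{n+1}$ be the lattice of noncrossing partitions of $\{1,\dots,n+1\}$, ordered by refinement. If $\sigma\lessdot\tau$ is a covering relation in $\mathrm{NC}_{n+1}$, then $\tau$ arises from $\sigma$ by joining two blocks $B_1,B_2$ of $\sigma$ into one block $B=B_1\cup B_2$ of $\tau$, where $B_1$ is taken to be the one containing $\min B$; the \emph{label} of $\sigma\lessdot\tau$ is the largest element of $B_1$ which is smaller than all elements of $B_2$. Reading the labels of a maximal chain of $\mathrm{NC}_{n+1}$ from bottom to top gives an $n$-tuple of integers, and each parking function of length $n$ is the label sequence of exactly one maximal chain. Let $\mathrm{Poset}(\mathrm{PF}_{n,k})$ be the poset whose Hasse diagram is the union of the maximal chains of $\mathrm{NC}_{n+1}$ whose label sequence lies in $\mathrm{PF}_{n,k}$: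 its elements are the noncrossing partitions lying on at least one of these chains, and $x\le y$ if and only if there is a path $x=z_0,z_1,\dots,z_m=y$ with $m\ge 0$ such that each $z_{i}\lessdot z_{i+1}$ is an edge of one of these chains (in general this is not the order induced from $\mathrm{NC}_{n+1}$). \textbf{Theorem B.} For all integers $1<k\le n$, the poset $\mathrm{Poset}(\mathrm{PF}_{n,k})$ is locally self-dual: for all $x\le y$ in $\mathrm{Poset}(\mathrm{PF}_{n,k})$, the interval $[x,y]=\{z : x\le z\le y\}$ of $\mathrm{Poset}(\mathrm{PF}_{n,k})$ is isomorphic, as a poset, to its order dual. -/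

import Mathlib

/-- The `n`-tuple `a` of positive integers is a parking function: some rearrangement of it is weakly
increasing with `i`-th entry at most `i`. (Positions are `0, …, n - 1`, so position `i` is the
`(i + 1)`-st entry.) -/
def IsParkingFunction {n : ℕ} (a : Fin n → ℕ) : Prop :=
  (∀ i, 1 ≤ a i) ∧
    ∃ s : Equiv.Perm (Fin n), Monotone (fun i => a (s i)) ∧ ∀ i : Fin n, a (s i) ≤ (i : ℕ) + 1

/-- The set `PF_{n,k}` of parking functions of length `n` whose largest missing number is `k`. -/
def PF (n k : ℕ) : Set (Fin n → ℕ) :=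
  {a | IsParkingFunction a ∧ (∀ i, a i ≠ k) ∧ ∀ j, k < j → j ≤ n → ∃ i, a i = j}

/-- A partition of `Fin m`, given as an equivalence relation, is noncrossing if there are no
`a < b < c < d` with `a, c` in one block and `b, d` in a different block. -/
def IsNoncrossing {m : ℕ} (σ : Setoid (Fin m)) : Prop :=
  ∀ a b c d : Fin m, a < b → b < c → c < d → σ a c → σ b d → σ a b

/-- The lattice `NC_m` of noncrossing partitions of an `m`-element cyclically ordered set, ordered
by refinement. The element `i : Fin m` stands for the number `i + 1` of `{1, …, m}`. -/
abbrev NC (m : ℕ) : Type := {σ : Setoid (Fin m) // IsNoncrossing σ}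

/-- `ℓ` is the label of the covering relation `σ ⋖ τ`: a block `B` of `τ` is the union of two
distinct blocks `B₁`, `B₂` of `σ`, where `B₁` contains the minimum of `B`, and `ℓ` is the largest
number in `B₁` which is less than all elements of `B₂`. -/
def IsEdgeLabel {m : ℕ} (σ τ : NC m) (ℓ : ℕ) : Prop :=
  ∃ B ∈ τ.1.classes, ∃ B₁ ∈ σ.1.classes, ∃ B₂ ∈ σ.1.classes,
    B₁ ≠ B₂ ∧ B = B₁ ∪ B₂ ∧ (∃ x ∈ B₁, IsLeast B x) ∧
      ∃ j : Fin m, IsGreatest {x | x ∈ B₁ ∧ ∀ y ∈ B₂, x < y} j ∧ ℓ = (j : ℕ) + 1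

/-- `c` is a maximal chain of `NC_{n+1}`: a path of covering relations from bottom to top. -/
def IsMaxChainNC {n : ℕ} (c : Fin (n + 1) → NC (n + 1)) : Prop :=
  (c 0).1 = ⊥ ∧ (c (Fin.last n)).1 = ⊤ ∧ ∀ i : Fin n, c i.castSucc ⋖ c i.succ

/-- The maximal chains of `NC_{n+1}` whose sequence of labels, read from bottom to top, lies in
`PF_{n,k}`. -/
def PFChains (n k : ℕ) : Set (Fin (n + 1) → NC (n + 1)) :=
  {c | IsMaxChainNC c ∧ ∃ a ∈ PF n k, ∀ i : Fin n, IsEdgeLabel (c i.castSucc) (c i.succ) (a i)}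

/-- The edges of the union of the chains in `PFChains n k`. -/
def PFEdge (n k : ℕ) (σ τ : NC (n + 1)) : Prop :=
  ∃ c ∈ PFChains n k, ∃ i : Fin n, c i.castSucc = σ ∧ c i.succ = τ

/-- The elements of `Poset(PF_{n,k})`: the noncrossing partitions on some chain in
`PFChains n k`. -/
structure PosetPF (n k : ℕ) : Type where
  /-- the underlying noncrossing partition -/
  val : NC (n + 1)
  mem_chain : ∃ c ∈ PFChains n k, ∃ i, c i = val

theorem PFEdge.le {n k : ℕ} {σ τ : NC (n + 1)} (h : PFEdge n k σ τ) : σ ≤ τ := by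
  obtain ⟨c, hc, i, rfl, rfl⟩ := h
  exact (hc.1.2.2 i).le

theorem PFEdge.le_of_reflTransGen {n k : ℕ} {σ τ : NC (n + 1)}
    (h : Relation.ReflTransGen (PFEdge n k) σ τ) : σ ≤ τ := by
  induction h with
  | refl => exact le_rfl
  | tail _ h ih => exact ih.trans h.le

/-- The order of `Poset(PF_{n,k})` is the one whose Hasse diagram is the union of the chains:
`x ≤ y` iff there is an upward path of edges from `x` to `y`. It is in general not the order
induced from `NC_{n+1}`. -/
instance PosetPF.instPartialOrder (n k : ℕ) : PartialOrder (PosetPF n k) where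
  le x y := Relation.ReflTransGen (PFEdge n k) x.val y.val
  le_refl _ := Relation.ReflTransGen.refl
  le_trans _ _ _ h₁ h₂ := Relation.ReflTransGen.trans h₁ h₂
  le_antisymm x y h₁ h₂ := by
    have h : x.val = y.val :=
      le_antisymm (PFEdge.le_of_reflTransGen h₁) (PFEdge.le_of_reflTransGen h₂)
    cases x
    cases y
    cases h
    rfl

/-!
Throughout, the element `a : Fin m` stands for the number `a + 1`, and edges of the noncrossing
partition lattice are described from above: `IsSplit σ τ a b` says that `σ` arises from `τ` by
cutting a block at `(a, b]`. The label of this edge is `a + 1`.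

The poset decomposes. On a chain with labels in `PF_{n,k}` each label above `k` is used, and counting
blocks of the restrictions to the final segments `[j, n]` shows that no step with a smaller label may
join two blocks which both reach into such a segment (`le_of_joining_step`). Hence all partitions on
the chain are convex above `k` (`convexAbove_of_chain`): such a partition is determined by its
restriction to the numbers `1, …, k + 1` and by the set of elements beyond that are joined to their
predecessors. Conversely every maximal path of convex edges avoiding the label `k` is one of the
chains (`PFEdge_iff`). So the order is the product of a Boolean lattice and the order by paths
without label `k` among noncrossing partitions of `1, …, k + 1` (`PosetPF.le_iff`).

The second factor is locally self-dual. Represent a noncrossing partition by the permutation whose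
cycles are its blocks in increasing order. Cutting at `(a, b]` is right multiplication by the
transposition `(a b)`. Let `X`, `Y` be the ends of an interval and `ρ` an involution that inverts
`K = X⁻¹ Y`. Then `z ↦ X ρ Y⁻¹ z ρ` is an involution which exchanges `X` and `Y` and sends a step
`z (a b)` to the step given by the transposition of `ρ a` and `ρ b`. The number of cycles changes by
at most one in each step and attains the extreme values at the ends, so the images of steps upwards
are cuts, and the image consists of noncrossing partitions. A step with label `k` must be the
transposition of `k` and `k + 1`, and can occur between `X` and `Y` only if `K` maps `k` to `k + 1`.
In this case the reflection `ρ` can be taken to exchange the two, so that these steps correspond to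
each other and paths without label `k` are mapped to paths without label `k` (`exists_dual`).
-/

/-! ### Cutting a block of a noncrossing partition -/

/-- The noncrossing partition `σ` arises from `τ` by cutting the block that contains `a < b` into
its part in the interval `(a, b]` and the rest. -/
def IsSplit {m : ℕ} (σ τ : NC m) (a b : Fin m) : Prop :=
  a < b ∧ τ.1 a b ∧ ∀ i j, σ.1 i j ↔ τ.1 i j ∧ (τ.1 i a → ((a < i ∧ i ≤ b) ↔ (a < j ∧ j ≤ b)))

theorem exists_isSplit {m : ℕ} (τ : NC m) {a b : Fin m} (hab : a < b) (h : τ.1 a b) :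
    ∃ σ : NC m, IsSplit σ τ a b := by
  refine ⟨⟨⟨fun i j => τ.1 i j ∧ (τ.1 i a → ((a < i ∧ i ≤ b) ↔ (a < j ∧ j ≤ b))), ?_⟩, ?_⟩,
    hab, h, fun _ _ => Iff.rfl⟩
  · refine ⟨fun i => ⟨τ.1.refl i, fun _ => Iff.rfl⟩, ?_, ?_⟩
    · rintro i j ⟨h1, h2⟩
      exact ⟨τ.1.symm h1, fun h3 => (h2 (τ.1.trans h1 h3)).symm⟩
    · rintro i j l ⟨h1, h2⟩ ⟨h3, h4⟩
      exact ⟨τ.1.trans h1 h3, fun h5 => (h2 h5).trans (h4 (τ.1.trans (τ.1.symm h1) h5))⟩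
  · rintro i j l r hij hjl hlr ⟨h1, h2⟩ ⟨h3, h4⟩
    have h5 := τ.2 i j l r hij hjl hlr h1 h3
    refine ⟨h5, fun h6 => ?_⟩
    have h7 := h2 h6
    have h8 := h4 (τ.1.trans (τ.1.symm h5) h6)
    omega

namespace IsSplit

variable {m : ℕ} {σ τ : NC m} {a b : Fin m}

theorem le (h : IsSplit σ τ a b) : σ ≤ τ := fun {i j} hij => ((h.2.2 i j).1 hij).1

theorem not_rel (h : IsSplit σ τ a b) : ¬ σ.1 a b := by
  intro h'
  have := ((h.2.2 a b).1 h').2 (τ.1.refl a)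
  have := h.1
  omega

/-- The two parts of the block that is cut are the blocks of `a` and `b`. -/
theorem rel_left (h : IsSplit σ τ a b) {i : Fin m} :
    σ.1 i a ↔ τ.1 i a ∧ ¬ (a < i ∧ i ≤ b) := by
  rw [h.2.2]
  have : ¬ (a < a ∧ a ≤ b) := by omega
  tauto

theorem rel_right (h : IsSplit σ τ a b) {i : Fin m} :
    σ.1 i b ↔ τ.1 i a ∧ (a < i ∧ i ≤ b) := by
  rw [h.2.2]
  have h1 : (a < b ∧ b ≤ b) := ⟨h.1, le_rfl⟩
  have h2 : τ.1 i b ↔ τ.1 i a :=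
    ⟨fun h' => τ.1.trans h' (τ.1.symm h.2.1), fun h' => τ.1.trans h' h.2.1⟩
  tauto

/-- A pair which is related in `τ` but not in `σ` has one member in each of the two parts. -/
theorem rel_cases (h : IsSplit σ τ a b) {i j : Fin m} (hij : τ.1 i j) :
    σ.1 i j ∨ (σ.1 i a ∧ σ.1 j b) ∨ (σ.1 i b ∧ σ.1 j a) := by
  rw [h.rel_left, h.rel_right, h.rel_right, h.rel_left, h.2.2]
  have h1 : τ.1 i a ↔ τ.1 j a :=
    ⟨fun h' => τ.1.trans (τ.1.symm hij) h', fun h' => τ.1.trans hij h'⟩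
  tauto

theorem covBy (h : IsSplit σ τ a b) : σ ⋖ τ := by
  refine ⟨lt_of_le_of_ne h.le ?_, ?_⟩
  · rintro rfl
    exact h.not_rel h.2.1
  · intro c hσ hτ
    have hle : ∀ {i j}, σ.1 i j → c.1 i j := fun {i j} hij => hσ.le hij
    have hle' : ∀ {i j}, c.1 i j → τ.1 i j := fun {i j} hij => hτ.le hij
    have hab : c.1 a b := by
      by_contra hab
      refine hσ.not_ge fun {i j} hij => ?_
      rcases h.rel_cases (hle' hij) with h1 | ⟨h1, h2⟩ | ⟨h1, h2⟩
      · exact h1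
      · exact absurd (c.1.trans (c.1.symm (hle h1)) (c.1.trans hij (hle h2))) hab
      · exact absurd (c.1.trans (c.1.symm (hle h2)) (c.1.trans (c.1.symm hij) (hle h1))) hab
    refine hτ.not_ge fun {i j} hij => ?_
    rcases h.rel_cases hij with h1 | ⟨h1, h2⟩ | ⟨h1, h2⟩
    · exact hle h1
    · exact c.1.trans (hle h1) (c.1.trans hab (c.1.symm (hle h2)))
    · exact c.1.trans (hle h1) (c.1.trans (c.1.symm hab) (c.1.symm (hle h2)))

theorem isEdgeLabel (h : IsSplit σ τ a b) : IsEdgeLabel σ τ ((a : ℕ) + 1) := by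
  refine ⟨{x | τ.1 x a}, ⟨a, rfl⟩, {x | σ.1 x a}, ⟨a, rfl⟩, {x | σ.1 x b}, ⟨b, rfl⟩, ?_, ?_, ?_,
    a, ⟨⟨σ.1.refl a, ?_⟩, ?_⟩, rfl⟩
  · intro he
    have : a ∈ {x | σ.1 x a} := σ.1.refl a
    rw [he] at this
    exact h.not_rel this
  · ext i
    simp only [Set.mem_ofPred_eq, Set.mem_union, h.rel_left, h.rel_right]
    tauto
  · obtain ⟨x, hx⟩ := (Set.toFinite {x | τ.1 x a}).exists_minimal ⟨a, τ.1.refl a⟩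
    have hl : IsLeast {x | τ.1 x a} x := ⟨hx.1, fun y hy => by
      rcases le_total x y with h' | h'
      · exact h'
      · exact hx.2 hy h'⟩
    refine ⟨x, h.rel_left.2 ⟨hx.1, fun h' => ?_⟩, hl⟩
    exact absurd (hl.2 (τ.1.refl a)) (not_le.2 h'.1)
  · intro y hy
    exact (h.rel_right.1 hy).2.1
  · rintro x ⟨hx, hxy⟩
    have h1 := h.rel_left.1 hx
    have h2 := hxy b (σ.1.refl b)
    by_contra h3
    exact h1.2 ⟨not_le.1 h3, h2.le⟩

end IsSplit

/-- Every labelled covering relation is a cut at `(a, b]`, where `a + 1` is the label and `b` the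
maximum of the block that does not contain the minimum of the union. -/
theorem IsEdgeLabel.exists_isSplit {m : ℕ} {σ τ : NC m} {l : ℕ} (hc : σ ⋖ τ)
    (h : IsEdgeLabel σ τ l) : ∃ a b : Fin m, l = (a : ℕ) + 1 ∧ IsSplit σ τ a b := by
  obtain ⟨B, ⟨u, rfl⟩, B₁, ⟨v, rfl⟩, B₂, ⟨w, rfl⟩, hne, hB, ⟨x, hx1, hx⟩, a, ⟨⟨ha1, ha2⟩, ha⟩, rfl⟩ := h
  have hle : ∀ {i j}, σ.1 i j → τ.1 i j := fun {i j} hij => hc.le hij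
  obtain ⟨b, hb⟩ := (Set.toFinite {x | σ.1 x w}).exists_maximal ⟨w, σ.1.refl w⟩
  have hbw : σ.1 b w := hb.1
  have hmax : ∀ y, σ.1 y w → y ≤ b := fun y hy => by
    rcases le_total y b with h' | h'
    · exact h'
    · exact hb.2 hy h'
  simp only [Set.mem_ofPred_eq] at ha1 ha2 hx1
  have hab : a < b := ha2 b hbw
  have hBi : ∀ i, τ.1 i u ↔ σ.1 i v ∨ σ.1 i w := fun i => by
    have := congrArg (i ∈ ·) hB
    simpa using this
  have hau : τ.1 a u := (hBi a).2 (Or.inl ha1)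
  have hbu : τ.1 b u := (hBi b).2 (Or.inr hbw)
  have hτ : τ.1 a b := τ.1.trans hau (τ.1.symm hbu)
  have hvw : ¬ σ.1 v w := by
    intro h'
    apply hne
    ext i
    exact ⟨fun h1 => σ.1.trans h1 h', fun h1 => σ.1.trans h1 (σ.1.symm h')⟩
  -- no element of the first block lies in `(a, b]`, because the two blocks do not cross
  have hgap : ∀ i, σ.1 i v → ¬ (a < i ∧ i ≤ b) := by
    rintro i hi ⟨h1, h2⟩
    have h3 : ¬ ∀ y, σ.1 y w → i < y := fun h3 => absurd (ha ⟨hi, h3⟩) (not_le.2 h1)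
    push Not at h3
    obtain ⟨y, hy, hyi⟩ := h3
    have h4 : y ≠ i := by
      rintro rfl
      exact hvw (σ.1.trans (σ.1.symm hi) hy)
    have h5 : i ≠ b := by
      rintro rfl
      exact hvw (σ.1.trans (σ.1.symm hi) hbw)
    have h6 := σ.2 a y i b (ha2 y hy) (lt_of_le_of_ne hyi h4) (lt_of_le_of_ne h2 h5)
      (σ.1.trans ha1 (σ.1.symm hi)) (σ.1.trans hy (σ.1.symm hbw))
    exact hvw (σ.1.trans (σ.1.symm ha1) (σ.1.trans h6 hy))
  obtain ⟨ρ, hρ⟩ := _root_.exists_isSplit τ hab hτ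
  have hσρ : σ ≤ ρ := by
    intro i j hij
    refine (hρ.2.2 i j).2 ⟨hle hij, fun hia => ?_⟩
    rcases (hBi i).1 (τ.1.trans hia hau) with h1 | h1
    · have h2 := hgap i h1
      have h3 := hgap j (σ.1.trans (σ.1.symm hij) h1)
      tauto
    · have h2 := σ.1.trans (σ.1.symm hij) h1
      exact ⟨fun _ => ⟨ha2 j h2, hmax j h2⟩, fun _ => ⟨ha2 i h1, hmax i h1⟩⟩
  have : σ = ρ := by
    rcases hσρ.lt_or_eq with h1 | h1
    · exact absurd hρ.covBy.lt (hc.2 h1)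
    · exact h1
  exact ⟨a, b, rfl, this ▸ hρ⟩

/-- The number of blocks. -/
noncomputable def numClasses {α : Type*} (s : Setoid α) : ℕ := Nat.card (Quotient s)

theorem numClasses_le_of_le {α : Type*} [Finite α] {s t : Setoid α} (h : ∀ i j, s i j → t i j) :
    numClasses t ≤ numClasses s :=
  Nat.card_le_card_of_surjective (Quotient.map' id fun i j hij => h i j hij : Quotient s → Quotient t)
    (fun q => Quotient.inductionOn' q fun i => ⟨Quotient.mk'' i, rfl⟩)

theorem numClasses_lt_of_le {α : Type*} [Finite α] {s t : Setoid α} (h : ∀ i j, s i j → t i j)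
    {a b : α} (ht : t a b) (hs : ¬ s a b) : numClasses t < numClasses s := by
  refine lt_of_le_of_ne (numClasses_le_of_le h) fun he => ?_
  have hsurj : Function.Surjective
      (Quotient.map' id fun i j hij => h i j hij : Quotient s → Quotient t) :=
    fun q => Quotient.inductionOn' q fun i => ⟨Quotient.mk'' i, rfl⟩
  have hinj := (Nat.bijective_iff_surjective_and_card _).2 ⟨hsurj, he.symm⟩ |>.1
  have := @hinj (Quotient.mk'' a) (Quotient.mk'' b) (Quotient.sound' ht)
  exact hs (Quotient.exact' this)

/-- If `t` relates no two elements outside the class of `b` that `s` does not relate, it has at most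
one class less than `s`. -/
theorem numClasses_le_add_one {α : Type*} [Finite α] {s t : Setoid α} {b : α}
    (h : ∀ i j, t i j → ¬ s i b → ¬ s j b → s i j) :
    numClasses s ≤ numClasses t + 1 := by
  classical
  have := Fintype.ofFinite (Quotient t)
  have hc : numClasses t + 1 = Nat.card (Option (Quotient t)) := by
    rw [numClasses, Nat.card_eq_fintype_card, Nat.card_eq_fintype_card, Fintype.card_option]
  rw [hc]
  refine Nat.card_le_card_of_injective
    (fun q : Quotient s => if q = Quotient.mk s b then none else some (Quotient.mk t q.out)) ?_
  intro p q hpq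
  by_cases hp : p = Quotient.mk s b <;> by_cases hq : q = Quotient.mk s b
  · rw [hp, hq]
  · simp [hp, hq] at hpq
  · simp [hp, hq] at hpq
  · simp only [hp, hq, if_false, Option.some.injEq] at hpq
    rw [← Quotient.out_eq p] at hp ⊢
    rw [← Quotient.out_eq q] at hq ⊢
    exact Quotient.sound (h _ _ (Quotient.exact hpq) (fun h' => hp (Quotient.sound h'))
      (fun h' => hq (Quotient.sound h')))

theorem IsSplit.numClasses_eq {m : ℕ} {σ τ : NC m} {a b : Fin m} (h : IsSplit σ τ a b) :
    numClasses σ.1 = numClasses τ.1 + 1 := by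
  refine le_antisymm (numClasses_le_add_one (b := b) fun i j hij hi hj => ?_)
    (numClasses_lt_of_le (fun i j hij => h.le hij) h.2.1 h.not_rel)
  rcases h.rel_cases hij with h1 | h1 | h1
  · exact h1
  · exact absurd h1.2 hj
  · exact absurd h1.1 hi

section Permutations

open Equiv

/-! ### Permutations representing partitions -/

/-- `j` follows `i` cyclically in the block of `i`. -/
def IsNext {m : ℕ} (σ : Setoid (Fin m)) (i j : Fin m) : Prop :=
  σ i j ∧ ((i < j ∧ ∀ l, σ i l → l ≤ i ∨ j ≤ l) ∨ (j ≤ i ∧ ∀ l, σ i l → j ≤ l ∧ l ≤ i))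

/-- The permutation `w` represents the partition `σ`: its cycles are the blocks of `σ`, each
traversed in increasing order. -/
def Represents {m : ℕ} (w : Perm (Fin m)) (σ : Setoid (Fin m)) : Prop := ∀ i, IsNext σ i (w i)

theorem IsNext.unique {m : ℕ} {σ : Setoid (Fin m)} {i j j' : Fin m} (h : IsNext σ i j)
    (h' : IsNext σ i j') : j = j' := by
  obtain ⟨h1, h2⟩ := h
  obtain ⟨h3, h4⟩ := h'
  rcases h2 with ⟨h2, h5⟩ | ⟨h2, h5⟩ <;> rcases h4 with ⟨h4, h6⟩ | ⟨h4, h6⟩ <;>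
    have h7 := h5 _ h3 <;> have h8 := h6 _ h1 <;> omega

theorem IsNext.injective {m : ℕ} {σ : Setoid (Fin m)} {i i' j : Fin m} (h : IsNext σ i j)
    (h' : IsNext σ i' j) : i = i' := by
  obtain ⟨h1, h2⟩ := h
  obtain ⟨h3, h4⟩ := h'
  have h9 := σ.trans h1 (σ.symm h3)
  rcases h2 with ⟨h2, h5⟩ | ⟨h2, h5⟩ <;> rcases h4 with ⟨h4, h6⟩ | ⟨h4, h6⟩ <;>
    have h7 := h5 _ h9 <;> have h8 := h6 _ (σ.symm h9) <;> omega

theorem exists_isNext {m : ℕ} (σ : Setoid (Fin m)) (i : Fin m) : ∃ j, IsNext σ i j := by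
  by_cases h : ∃ l, i < l ∧ σ i l
  · obtain ⟨j, hj⟩ := (Set.toFinite {l | i < l ∧ σ i l}).exists_minimal h
    refine ⟨j, hj.1.2, Or.inl ⟨hj.1.1, fun l hl => ?_⟩⟩
    by_contra! h'
    exact absurd (hj.2 ⟨h'.1, hl⟩ h'.2.le) (not_le.2 h'.2)
  · push Not at h
    obtain ⟨j, hj⟩ := (Set.toFinite {l | σ i l}).exists_minimal ⟨i, σ.refl i⟩
    have hmin : ∀ l, σ i l → j ≤ l := fun l hl => by
      rcases le_total j l with h' | h'
      · exact h'
      · exact hj.2 hl h'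
    exact ⟨j, hj.1, Or.inr ⟨hmin i (σ.refl i), fun l hl =>
      ⟨hmin l hl, not_lt.1 fun h' => h l h' hl⟩⟩⟩

theorem exists_represents {m : ℕ} (σ : Setoid (Fin m)) : ∃ w, Represents w σ := by
  choose f hf using exists_isNext σ
  have hinj : Function.Injective f := fun i i' h => (hf i).injective (h ▸ hf i')
  exact ⟨Equiv.ofBijective f (Finite.injective_iff_bijective.1 hinj), hf⟩

namespace Represents

variable {m : ℕ} {σ τ : Setoid (Fin m)} {w v : Perm (Fin m)}

theorem perm_unique (h : Represents w σ) (h' : Represents v σ) : w = v :=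
  Equiv.ext fun i => (h i).unique (h' i)

theorem rel_of_sameCycle {s : Setoid (Fin m)} (h : ∀ i, s i (w i)) {i j : Fin m}
    (hij : w.SameCycle i j) : s i j := by
  obtain ⟨n, rfl⟩ := hij.exists_nat_pow_eq
  clear hij
  induction n with
  | zero => exact s.refl i
  | succ n ih =>
    rw [pow_succ', Perm.mul_apply]
    exact s.trans ih (h _)

/-- The greatest element of a cycle of `w` is mapped to something smaller, so that it is the
greatest element of its block. -/
theorem exists_sameCycle_max (h : Represents w σ) (i : Fin m) :
    ∃ j, w.SameCycle i j ∧ ∀ l, σ i l → l ≤ j := by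
  obtain ⟨j, hj⟩ := (Set.toFinite {l | w.SameCycle i l}).exists_maximal ⟨i, Perm.SameCycle.refl w i⟩
  have hij : w.SameCycle i j := hj.1
  have h1 : w j ≤ j := by
    rcases le_total (w j) j with h' | h'
    · exact h'
    · exact hj.2 (Perm.sameCycle_apply_right.2 hij) h'
  refine ⟨j, hij, fun l hl => ?_⟩
  have h2 : σ j l := σ.trans (σ.symm (rel_of_sameCycle (fun i => (h i).1) hij)) hl
  rcases (h j).2 with ⟨h3, _⟩ | ⟨_, h3⟩
  · exact absurd h1 (not_le.2 h3)
  · exact (h3 l h2).2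

theorem sameCycle_iff (h : Represents w σ) {i j : Fin m} : w.SameCycle i j ↔ σ i j := by
  have hc : ∀ {i j}, w.SameCycle i j → σ i j := rel_of_sameCycle fun i => (h i).1
  refine ⟨hc, fun hij => ?_⟩
  obtain ⟨a, ha, ha'⟩ := h.exists_sameCycle_max i
  obtain ⟨b, hb, hb'⟩ := h.exists_sameCycle_max j
  have : a = b := le_antisymm (hb' a (σ.trans (σ.symm hij) (hc ha)))
    (ha' b (σ.trans hij (hc hb)))
  subst this
  exact ha.trans hb.symm

theorem unique (h : Represents w σ) (h' : Represents w τ) : σ = τ :=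
  Setoid.ext fun _ _ => h.sameCycle_iff.symm.trans h'.sameCycle_iff

/-- Cutting a block at `(a, b]` multiplies the permutation by the transposition `(a b)`. -/
theorem mul_swap {σ τ : NC m} {a b : Fin m} (hs : IsSplit σ τ a b) (h : Represents w τ.1) :
    Represents (w * swap a b) σ.1 := by
  have hab := hs.1
  have hτ := hs.2.1
  have hw : ∀ i, τ.1 i (w i) := fun i => (h i).1
  have hσ := fun i j => hs.2.2 i j
  intro i
  rw [Perm.mul_apply]
  by_cases hia : i = a
  · subst hia
    rw [swap_apply_left]
    have hb := h b
    have hi := hs.rel_left (i := w b)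
    have h1 : τ.1 (w b) i := τ.1.trans (τ.1.symm (hw b)) (τ.1.symm hτ)
    obtain ⟨-, hb⟩ := hb
    rcases hb with ⟨hb1, hb2⟩ | ⟨hb1, hb2⟩
    · refine ⟨σ.1.symm (hi.2 ⟨h1, by omega⟩), Or.inl ⟨by omega, fun l hl => ?_⟩⟩
      have h2 := hs.rel_left.1 (σ.1.symm hl)
      have := hb2 l (τ.1.trans (τ.1.symm hτ) (τ.1.symm h2.1))
      omega
    · have h3 := hb2 i (τ.1.symm hτ)
      refine ⟨σ.1.symm (hi.2 ⟨h1, by omega⟩), Or.inr ⟨by omega, fun l hl => ?_⟩⟩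
      have h2 := hs.rel_left.1 (σ.1.symm hl)
      have := hb2 l (τ.1.trans (τ.1.symm hτ) (τ.1.symm h2.1))
      omega
  by_cases hib : i = b
  · subst hib
    rw [swap_apply_right]
    have ha := h a
    have h1 : τ.1 (w a) a := τ.1.symm (hw a)
    obtain ⟨-, ha⟩ := ha
    rcases ha with ⟨hb1, hb2⟩ | ⟨hb1, hb2⟩
    · have h3 := hb2 i hτ
      refine ⟨σ.1.symm (hs.rel_right.2 ⟨h1, by omega⟩), Or.inr ⟨by omega, fun l hl => ?_⟩⟩
      have h2 := hs.rel_right.1 (σ.1.symm hl)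
      have := hb2 l (τ.1.symm h2.1)
      omega
    · have h3 := hb2 i hτ
      omega
  rw [swap_apply_of_ne_of_ne hia hib]
  obtain ⟨h1, h2⟩ := h i
  by_cases hc : τ.1 i a
  · have h3 : τ.1 i b := τ.1.trans hc hτ
    rcases h2 with ⟨h2, h4⟩ | ⟨h2, h4⟩
    · have h5 := h4 a hc
      have h6 := h4 b h3
      refine ⟨(hσ _ _).2 ⟨h1, fun _ => by omega⟩, Or.inl ⟨h2, fun l hl => ?_⟩⟩
      exact h4 l (hs.le hl)
    · have h5 := h4 a hc
      have h6 := h4 b h3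
      refine ⟨(hσ _ _).2 ⟨h1, fun _ => by omega⟩, Or.inr ⟨h2, fun l hl => ?_⟩⟩
      exact h4 l (hs.le hl)
  · refine ⟨(hσ _ _).2 ⟨h1, fun h' => absurd h' hc⟩, ?_⟩
    rcases h2 with ⟨h2, h4⟩ | ⟨h2, h4⟩
    · exact Or.inl ⟨h2, fun l hl => h4 l (hs.le hl)⟩
    · exact Or.inr ⟨h2, fun l hl => h4 l (hs.le hl)⟩

end Represents

/-- The number of cycles of a permutation, fixed points included. -/
noncomputable def numCycles {m : ℕ} (w : Perm (Fin m)) : ℕ := numClasses (Perm.SameCycle.setoid w)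

theorem Represents.numCycles_eq {m : ℕ} {σ : Setoid (Fin m)} {w : Perm (Fin m)}
    (h : Represents w σ) : numCycles w = numClasses σ := by
  have : Perm.SameCycle.setoid w = σ := Setoid.ext fun i j => h.sameCycle_iff
  rw [numCycles, this]

/-- The setoid obtained from `s` by joining the classes of `a` and `b`. -/
def joinClasses {α : Type*} (s : Setoid α) (a b : α) : Setoid α where
  r i j := s i j ∨ ((s i a ∨ s i b) ∧ (s j a ∨ s j b))
  iseqv := by
    refine ⟨fun i => Or.inl (s.refl i), ?_, ?_⟩
    · rintro i j (h | h)
      · exact Or.inl (s.symm h)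
      · exact Or.inr h.symm
    · rintro i j l (h | ⟨h, h'⟩) (h1 | ⟨h1, h2⟩)
      · exact Or.inl (s.trans h h1)
      · exact Or.inr ⟨h1.imp (s.trans h) (s.trans h), h2⟩
      · exact Or.inr ⟨h, h'.imp (s.trans (s.symm h1)) (s.trans (s.symm h1))⟩
      · exact Or.inr ⟨h, h2⟩

theorem joinClasses_iff {α : Type*} {s : Setoid α} {a b i j : α} :
    joinClasses s a b i j ↔ s i j ∨ ((s i a ∨ s i b) ∧ (s j a ∨ s j b)) := Iff.rfl

theorem numClasses_le_joinClasses {α : Type*} [Finite α] (s : Setoid α) (a b : α) :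
    numClasses s ≤ numClasses (joinClasses s a b) + 1 := by
  refine numClasses_le_add_one (b := b) fun i j h hi hj => ?_
  rcases h with h | ⟨h1, h2⟩
  · exact h
  · exact s.trans (h1.resolve_right hi) (s.symm (h2.resolve_right hj))

theorem sameCycle_le_joinClasses {m : ℕ} (w : Perm (Fin m)) (a b : Fin m) {i j : Fin m}
    (h : w.SameCycle i j) : joinClasses (Perm.SameCycle.setoid (w * swap a b)) a b i j := by
  refine Represents.rel_of_sameCycle (fun i => ?_) h
  set v := w * swap a b with hv
  have hvi : ∀ i, (Perm.SameCycle.setoid v) i (v i) := fun i =>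
    Perm.sameCycle_apply_right.2 (Perm.SameCycle.refl v i)
  have hw : w i = v (swap a b i) := by simp [hv, Perm.mul_apply]
  rw [hw, joinClasses_iff]
  have hr := fun i => (Perm.SameCycle.setoid v).refl i
  have hs : ∀ i, (Perm.SameCycle.setoid v) (v i) i := fun i => (Perm.SameCycle.setoid v).symm (hvi i)
  by_cases hia : i = a
  · subst hia
    rw [swap_apply_left]
    exact Or.inr ⟨Or.inl (hr i), Or.inr (hs b)⟩
  by_cases hib : i = b
  · subst hib
    rw [swap_apply_right]
    exact Or.inr ⟨Or.inr (hr i), Or.inl (hs a)⟩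
  rw [swap_apply_of_ne_of_ne hia hib]
  exact Or.inl (hvi i)

theorem numCycles_mul_swap_le {m : ℕ} (w : Perm (Fin m)) (a b : Fin m) :
    numCycles (w * swap a b) ≤ numCycles w + 1 :=
  (numClasses_le_joinClasses _ a b).trans
    (Nat.add_le_add_right (numClasses_le_of_le fun _ _ => sameCycle_le_joinClasses w a b) 1)

/-- Only a transposition of two elements of one cycle can raise the number of cycles. -/
theorem sameCycle_of_numCycles_lt {m : ℕ} {w : Perm (Fin m)} {a b : Fin m}
    (h : numCycles w < numCycles (w * swap a b)) : w.SameCycle a b := by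
  by_contra hab
  have h1 := numClasses_le_joinClasses (Perm.SameCycle.setoid (w * swap a b)) a b
  have h2 : numClasses (joinClasses (Perm.SameCycle.setoid (w * swap a b)) a b) < numCycles w :=
    numClasses_lt_of_le (fun _ _ => sameCycle_le_joinClasses w a b) (a := a) (b := b)
      (Or.inr ⟨Or.inl (Perm.SameCycle.refl _ _), Or.inr (Perm.SameCycle.refl _ _)⟩) hab
  unfold numCycles at h h2
  omega

/-! ### Duality of intervals of noncrossing partitions -/

/-- Every permutation `K` is inverted by an involution `ρ` (a reflection of each of its cycles), and
the image under `ρ` of one point `p` may be prescribed to be `K p`. -/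
theorem exists_reflection {α : Type*} (K : Perm α) (p : α) :
    ∃ ρ : Perm α, ρ * ρ = 1 ∧ ρ * K * ρ = K⁻¹ ∧ ρ p = K p := by
  classical
  -- `r` is a system of representatives for the cycles in which `p` stands for its own cycle
  obtain ⟨r, hr, hr', hrp⟩ : ∃ r : α → α, (∀ i, K.SameCycle (r i) i) ∧
      (∀ i j, K.SameCycle i j → r i = r j) ∧ r p = p := by
    refine ⟨fun i => if K.SameCycle i p then p else
      (Quotient.mk (Perm.SameCycle.setoid K) i).out, fun i => ?_, fun i j hij => ?_, ?_⟩
    · dsimp only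
      split_ifs with h
      · exact h.symm
      · exact Quotient.mk_out (s := Perm.SameCycle.setoid K) i
    · have h1 : K.SameCycle i p ↔ K.SameCycle j p :=
        ⟨fun h => hij.symm.trans h, fun h => hij.trans h⟩
      have h2 : Quotient.mk (Perm.SameCycle.setoid K) i = Quotient.mk (Perm.SameCycle.setoid K) j :=
        Quotient.sound hij
      simp only [h1, h2]
    · simp [Perm.SameCycle.refl]
  choose n hn using hr
  have hwd : ∀ i (l : ℤ), (K ^ l) (r i) = i → (K ^ (1 - n i)) (r i) = (K ^ (1 - l)) (r i) := by
    intro i l hl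
    have h1 : (K ^ (1 - l - n i)) ((K ^ l) (r i)) = (K ^ (1 - l - n i)) ((K ^ n i) (r i)) := by
      rw [hl, hn]
    rw [← Perm.mul_apply, ← Perm.mul_apply, ← zpow_add, ← zpow_add] at h1
    convert h1 using 3 <;> ring
  set g : α → α := fun i => (K ^ (1 - n i)) (r i) with hg
  have hgl : ∀ i (l : ℤ), g ((K ^ l) (r i)) = (K ^ (1 - l)) (r i) := by
    intro i l
    have h1 : r ((K ^ l) (r i)) = r i := by
      apply hr'
      have : K.SameCycle (r i) i := ⟨n i, hn i⟩
      exact (Perm.sameCycle_zpow_left).2 this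
    have := hwd ((K ^ l) (r i)) l (by rw [h1])
    rw [h1] at this
    simp only [hg, h1, this]
  have hgg : Function.Involutive g := by
    intro i
    rw [show g i = (K ^ (1 - n i)) (r i) from rfl, hgl]
    simp [hn]
  refine ⟨hgg.toPerm, ?_, ?_, ?_⟩
  · ext i
    exact hgg i
  · rw [eq_inv_iff_mul_eq_one]
    ext i
    show g (K (g (K i))) = i
    have h1 : K i = (K ^ (1 + n i)) (r i) := by
      rw [zpow_add, Perm.mul_apply, hn, zpow_one]
    rw [h1, hgl, ← Perm.mul_apply, ← zpow_one_add, hgl]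
    rw [show (1 - (1 + (1 - (1 + n i)))) = n i by ring, hn]
  · show g p = K p
    have := hgl p 0
    rw [hrp] at this
    simpa using this

/-- `τ` is reached from `σ` by undoing cuts, none of which has the label of `p`, namely
`(p : ℕ) + 1`. -/
def Reach {m : ℕ} (p : Fin m) : NC m → NC m → Prop :=
  Relation.ReflTransGen fun σ τ => ∃ a b, IsSplit σ τ a b ∧ a ≠ p

/-- `τ` is reached from `σ` by undoing cuts. -/
def ReachNC {m : ℕ} : NC m → NC m → Prop :=
  Relation.ReflTransGen fun σ τ => ∃ a b, IsSplit σ τ a b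

theorem Reach.reachNC {m : ℕ} {p : Fin m} {σ τ : NC m} (h : Reach p σ τ) : ReachNC σ τ :=
  Relation.ReflTransGen.mono (fun _ _ ⟨a, b, h, _⟩ => ⟨a, b, h⟩) _ _ h

theorem ReachNC.le {m : ℕ} {σ τ : NC m} (h : ReachNC σ τ) : σ ≤ τ := by
  induction h with
  | refl => exact le_rfl
  | tail _ h ih =>
    obtain ⟨a, b, h⟩ := h
    exact ih.trans h.le

theorem Reach.le {m : ℕ} {p : Fin m} {σ τ : NC m} (h : Reach p σ τ) : σ ≤ τ := h.reachNC.le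

/-- The permutation representing a noncrossing partition. -/
noncomputable def toPerm {m : ℕ} (σ : NC m) : Perm (Fin m) := (exists_represents σ.1).choose

theorem toPerm_represents {m : ℕ} (σ : NC m) : Represents (toPerm σ) σ.1 :=
  (exists_represents σ.1).choose_spec

theorem numCycles_toPerm {m : ℕ} (σ : NC m) : numCycles (toPerm σ) = numClasses σ.1 :=
  (toPerm_represents σ).numCycles_eq

theorem IsSplit.toPerm_eq {m : ℕ} {σ τ : NC m} {a b : Fin m} (h : IsSplit σ τ a b) :
    toPerm τ = toPerm σ * swap a b := by
  have := (toPerm_represents σ).perm_unique ((toPerm_represents τ).mul_swap h)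
  rw [this, mul_assoc, swap_mul_self, mul_one]

/-- The map on permutations that induces the duality of the interval between `X` and `Y`, where
`ρ` is an involution that inverts `(toPerm X)⁻¹ * toPerm Y`. -/
noncomputable def dualPerm {m : ℕ} (X Y : NC m) (ρ : Perm (Fin m)) (z : NC m) : Perm (Fin m) :=
  toPerm X * ρ * (toPerm Y)⁻¹ * toPerm z * ρ

section Dual

variable {m : ℕ} {X Y z z' u u' : NC m} {ρ : Perm (Fin m)} {a b : Fin m}

theorem dualPerm_eq_mul_swap (hρ : ρ * ρ = 1) (h : IsSplit z z' a b) :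
    dualPerm X Y ρ z' = dualPerm X Y ρ z * swap (ρ a) (ρ b) := by
  have h1 : ρ⁻¹ = ρ := inv_eq_of_mul_eq_one_left hρ
  have h2 := swap_mul_eq_mul_swap ρ a b
  rw [h1] at h2
  simp only [dualPerm, h.toPerm_eq, mul_assoc, h2]

theorem reflect_inv {x y : Perm (Fin m)} (hρ : ρ * ρ = 1)
    (hK : ρ * (x⁻¹ * y) * ρ = (x⁻¹ * y)⁻¹) : ρ * (y⁻¹ * x) * ρ = x⁻¹ * y := by
  have h1 : y⁻¹ * x = ρ * (x⁻¹ * y) * ρ := by rw [hK, mul_inv_rev, inv_inv]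
  rw [h1]
  calc ρ * (ρ * (x⁻¹ * y) * ρ) * ρ = (ρ * ρ) * (x⁻¹ * y) * (ρ * ρ) := by group
    _ = x⁻¹ * y := by rw [hρ, one_mul, mul_one]

theorem dualPerm_left (hρ : ρ * ρ = 1)
    (hK : ρ * ((toPerm X)⁻¹ * toPerm Y) * ρ = ((toPerm X)⁻¹ * toPerm Y)⁻¹) :
    dualPerm X Y ρ X = toPerm Y := by
  rw [dualPerm]
  calc _ = toPerm X * (ρ * ((toPerm Y)⁻¹ * toPerm X) * ρ) := by group
    _ = _ := by rw [reflect_inv hρ hK, mul_inv_cancel_left]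

theorem dualPerm_right (hρ : ρ * ρ = 1) : dualPerm X Y ρ Y = toPerm X := by
  rw [dualPerm, inv_mul_cancel_right, mul_assoc, hρ, mul_one]

theorem dualPerm_dualPerm (hρ : ρ * ρ = 1)
    (hK : ρ * ((toPerm X)⁻¹ * toPerm Y) * ρ = ((toPerm X)⁻¹ * toPerm Y)⁻¹)
    (hu : toPerm u = dualPerm X Y ρ z) : dualPerm X Y ρ u = toPerm z := by
  rw [dualPerm, hu, dualPerm]
  calc _ = toPerm X * (ρ * ((toPerm Y)⁻¹ * toPerm X) * ρ) * (toPerm Y)⁻¹ * toPerm z * (ρ * ρ) := by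
        group
    _ = _ := by
        rw [reflect_inv hρ hK, hρ, mul_inv_cancel_left, mul_inv_cancel, one_mul, mul_one]

/-- One step up removes one block of `z` and adds at most one cycle to its dual. -/
theorem numCycles_dualPerm_le (hρ : ρ * ρ = 1) (h : ReachNC z z') :
    numCycles (dualPerm X Y ρ z') + numClasses z'.1 ≤
      numCycles (dualPerm X Y ρ z) + numClasses z.1 := by
  induction h with
  | refl => exact le_rfl
  | @tail v _ _ h ih =>
    obtain ⟨a, b, h⟩ := h
    have h1 := h.numClasses_eq
    have h2 := numCycles_mul_swap_le (dualPerm X Y ρ v) (ρ a) (ρ b)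
    rw [← dualPerm_eq_mul_swap hρ h] at h2
    omega

/-- As both ends of the interval attain the bound of `numCycles_dualPerm_le`, so does everything
in between. -/
theorem numCycles_dualPerm_eq (hρ : ρ * ρ = 1)
    (hK : ρ * ((toPerm X)⁻¹ * toPerm Y) * ρ = ((toPerm X)⁻¹ * toPerm Y)⁻¹)
    (h : ReachNC X z) (h' : ReachNC z Y) :
    numCycles (dualPerm X Y ρ z) + numClasses z.1 = numClasses X.1 + numClasses Y.1 := by
  have h1 := numCycles_dualPerm_le (X := X) (Y := Y) hρ h
  have h2 := numCycles_dualPerm_le (X := X) (Y := Y) hρ h'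
  rw [dualPerm_left hρ hK, numCycles_toPerm] at h1
  rw [dualPerm_right hρ, numCycles_toPerm] at h2
  omega

/-- The dual of a step from `z` up to `z'` is a step from the dual of `z` down to the dual of `z'`:
it multiplies by a transposition and, by `numCycles_dualPerm_eq`, raises the number of cycles, so
it cuts a block. -/
theorem isSplit_of_dualPerm (hρ : ρ * ρ = 1)
    (hK : ρ * ((toPerm X)⁻¹ * toPerm Y) * ρ = ((toPerm X)⁻¹ * toPerm Y)⁻¹)
    (h : ReachNC X z) (h' : ReachNC z' Y) (hs : IsSplit z z' a b)
    (hu : toPerm u = dualPerm X Y ρ z) :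
    ∃ u' c d, IsSplit u' u c d ∧ toPerm u' = dualPerm X Y ρ z' ∧ swap c d = swap (ρ a) (ρ b) := by
  have h1 := numCycles_dualPerm_eq hρ hK h (h'.head ⟨a, b, hs⟩)
  have h2 := numCycles_dualPerm_eq hρ hK (h.tail ⟨a, b, hs⟩) h'
  have h3 := hs.numClasses_eq
  have h4 := dualPerm_eq_mul_swap (X := X) (Y := Y) hρ hs
  have h5 : u.1 (ρ a) (ρ b) := by
    rw [← (toPerm_represents u).sameCycle_iff, hu]
    apply sameCycle_of_numCycles_lt
    rw [← h4]
    omega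
  have h6 : ρ a ≠ ρ b := ρ.injective.ne hs.1.ne
  obtain ⟨c, d, hcd, hu1, hsw⟩ : ∃ c d, c < d ∧ u.1 c d ∧ swap c d = swap (ρ a) (ρ b) := by
    rcases lt_or_gt_of_ne h6 with h7 | h7
    · exact ⟨_, _, h7, h5, rfl⟩
    · exact ⟨_, _, h7, u.1.symm h5, swap_comm _ _⟩
  obtain ⟨u', hu'⟩ := exists_isSplit u hcd hu1
  refine ⟨u', c, d, hu', ?_, hsw⟩
  rw [h4, ← hu, ← hsw]
  exact (toPerm_represents u').perm_unique ((toPerm_represents u).mul_swap hu')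

/-- The dual permutation of a partition between `X` and `Y` represents a noncrossing partition, as
it arises from `Y` by cuts. -/
theorem exists_toPerm_eq_dualPerm (hρ : ρ * ρ = 1)
    (hK : ρ * ((toPerm X)⁻¹ * toPerm Y) * ρ = ((toPerm X)⁻¹ * toPerm Y)⁻¹)
    (h : ReachNC X z) (h' : ReachNC z Y) : ∃ u, toPerm u = dualPerm X Y ρ z := by
  induction h with
  | refl => exact ⟨Y, (dualPerm_left hρ hK).symm⟩
  | tail h1 h2 ih =>
    obtain ⟨a, b, h2⟩ := h2
    obtain ⟨u, hu⟩ := ih (h'.head ⟨a, b, h2⟩)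
    obtain ⟨u', _, _, _, h3, _⟩ := isSplit_of_dualPerm hρ hK h1 h' h2 hu
    exact ⟨u', h3⟩

theorem toPerm_injective : Function.Injective (toPerm : NC m → Perm (Fin m)) := fun σ τ h =>
  Subtype.ext ((toPerm_represents σ).unique (h ▸ toPerm_represents τ))

theorem reachNC_dual (hρ : ρ * ρ = 1)
    (hK : ρ * ((toPerm X)⁻¹ * toPerm Y) * ρ = ((toPerm X)⁻¹ * toPerm Y)⁻¹)
    (h : ReachNC X z) (h' : ReachNC z Y) (hu : toPerm u = dualPerm X Y ρ z) :
    ReachNC X u ∧ ReachNC u Y := by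
  constructor
  · induction h' using Relation.ReflTransGen.head_induction_on generalizing u with
    | refl =>
      rw [dualPerm_right hρ] at hu
      rw [toPerm_injective hu]
      exact .refl
    | head h1 h2 ih =>
      obtain ⟨a, b, h1⟩ := h1
      obtain ⟨u', c, d, h3, h4, _⟩ := isSplit_of_dualPerm hρ hK h h2 h1 hu
      exact (ih (h.tail ⟨a, b, h1⟩) h4).tail ⟨c, d, h3⟩
  · induction h generalizing u with
    | refl =>
      rw [dualPerm_left hρ hK] at hu
      rw [toPerm_injective hu]
      exact .refl
    | tail h1 h2 ih =>
      obtain ⟨a, b, h2⟩ := h2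
      have h3 := h'.head ⟨a, b, h2⟩
      obtain ⟨v, hv⟩ := exists_toPerm_eq_dualPerm hρ hK h1 h3
      obtain ⟨u', c, d, h4, h5, _⟩ := isSplit_of_dualPerm hρ hK h1 h' h2 hv
      rw [← hu] at h5
      rw [← toPerm_injective h5]
      exact (ih h3 hv).head ⟨c, d, h4⟩

end Dual

/-- Let no nontrivial block of `Y` contain an element beyond the successor `q` of `p`. A cut at
`(p, b]` between `X` and `Y` then cuts off the single element `q`, which is a singleton of `X`, and
the relative complement of `X` in `Y` maps `p` to `q`. -/
theorem complement_apply {m : ℕ} {X Y z z' : NC m} {p q b : Fin m} (hpq : (q : ℕ) = p + 1)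
    (hY : ∀ i j, Y.1 i j → i ≠ j → i ≤ q) (h : ReachNC X z) (h' : ReachNC z' Y)
    (hs : IsSplit z z' p b) : b = q ∧ ((toPerm X)⁻¹ * toPerm Y) p = q := by
  have hp := hs.1
  have hpb : Y.1 p b := h'.le hs.2.1
  have hb : b = q := by
    have := hY b p (Y.1.symm hpb) hp.ne'
    omega
  subst hb
  refine ⟨rfl, ?_⟩
  have h1 : ∀ j, X.1 b j → j = b := by
    intro j hj
    have h2 := hs.rel_right.1 (z.1.symm (h.le hj))
    omega
  have h3 : toPerm X b = b := h1 _ (toPerm_represents X b).1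
  have h4 : toPerm Y p = b := by
    obtain ⟨h5, h6⟩ := toPerm_represents Y p
    rcases h6 with ⟨h6, h7⟩ | ⟨h6, h7⟩
    · have := h7 b hpb
      omega
    · have := h7 b hpb
      omega
  rw [Perm.mul_apply, h4, Perm.inv_eq_iff_eq, h3]

/-- Local self-duality of the noncrossing partitions under `Reach p`, below a partition without
nontrivial blocks beyond the successor `q` of `p`. The involution `f` is
`z ↦ X * ρ * Y⁻¹ * z * ρ` in terms of permutations, where the reflection `ρ` of `X⁻¹ * Y` is chosen
to exchange `p` and `q` if `X⁻¹ * Y` maps `p` to `q`. -/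
theorem exists_dual {m : ℕ} (X Y : NC m) {p q : Fin m} (hpq : (q : ℕ) = p + 1)
    (hY : ∀ i j, Y.1 i j → i ≠ j → i ≤ q) :
    ∃ f : NC m → NC m, ∀ z, Reach p X z → Reach p z Y →
      Reach p X (f z) ∧ Reach p (f z) Y ∧ f (f z) = z ∧
        ∀ z', Reach p z z' → Reach p z' Y → Reach p (f z') (f z) := by
  classical
  obtain ⟨ρ, hρ, hK, hρp⟩ := exists_reflection ((toPerm X)⁻¹ * toPerm Y) p
  obtain ⟨f, hf⟩ : ∃ f : NC m → NC m, ∀ z, ReachNC X z → ReachNC z Y →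
      toPerm (f z) = dualPerm X Y ρ z := by
    choose g hg using fun z (hz : ReachNC X z ∧ ReachNC z Y) =>
      exists_toPerm_eq_dualPerm hρ hK hz.1 hz.2
    exact ⟨fun z => if hz : ReachNC X z ∧ ReachNC z Y then g z hz else z, fun z h h' => by
      simpa [h, h'] using hg z ⟨h, h'⟩⟩
  have hanti : ∀ z z', Reach p X z → Reach p z z' → Reach p z' Y → Reach p (f z') (f z) := by
    intro z z' h h1 h2
    induction h1 with
    | refl => exact .refl
    | @tail v v' h3 h4 ih =>
      refine Relation.ReflTransGen.trans ?_ (ih (h2.head h4))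
      obtain ⟨a, b, h4, hap⟩ := h4
      have h5 : ReachNC X v := Reach.reachNC (h.trans h3)
      have h6 : ReachNC v Y := h2.reachNC.head ⟨a, b, h4⟩
      have h7 := hf v h5 h6
      obtain ⟨u', c, d, h8, h9, h10⟩ := isSplit_of_dualPerm hρ hK h5 h2.reachNC h4 h7
      have h5' : ReachNC X v' := h5.tail ⟨a, b, h4⟩
      have h11 : u' = f v' := toPerm_injective (h9.trans (hf v' h5' h2.reachNC).symm)
      subst h11
      refine .single ⟨c, d, h8, ?_⟩
      -- if the dual cut had the forbidden label, `ρ` would exchange `p` and its successor, so that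
      -- the given cut would have the forbidden label as well
      rintro rfl
      obtain ⟨rfl, h12⟩ := complement_apply hpq hY
        (reachNC_dual hρ hK h5' h2.reachNC h9).1 (reachNC_dual hρ hK h5 h6 h7).2 h8
      rw [h12] at hρp
      have h13 : ∀ i, ρ (ρ i) = i := fun i => by rw [← Perm.mul_apply, hρ, Perm.one_apply]
      have h14 : ρ d = c := by rw [← hρp, h13]
      have hab := h4.1
      have hcd := h8.1
      have h15 : ρ a = c ∨ ρ a = d := by
        by_contra! h
        have h16 := congrArg (fun w => w (ρ a)) h10
        simp only [swap_apply_left, swap_apply_of_ne_of_ne h.1 h.2] at h16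
        exact hab.ne (ρ.injective h16)
      rcases h15 with h15 | h15
      · have h16 : a = d := by rw [← h13 a, h15, hρp]
        have h17 : ρ b = d := by
          have h17 := congrArg (fun w => w (ρ a)) h10
          simp only [h15, swap_apply_left] at h17
          exact h17.symm
        have h18 : b = c := by rw [← h13 b, h17, h14]
        omega
      · exact hap (by rw [← h13 a, h15, h14])
  refine ⟨f, fun z h h' => ?_⟩
  have hXY : ReachNC X Y := Reach.reachNC (h.trans h')
  have h1 : f Y = X := toPerm_injective ((hf Y hXY .refl).trans (dualPerm_right hρ))
  have h2 : f X = Y := toPerm_injective ((hf X .refl hXY).trans (dualPerm_left hρ hK))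
  have h3 := hanti z Y h h' .refl
  have h4 := hanti X z .refl h h'
  rw [h1] at h3
  rw [h2] at h4
  refine ⟨h3, h4, ?_, fun z' hz hz' => hanti z z' h hz hz'⟩
  have h5 := hf z h.reachNC h'.reachNC
  exact toPerm_injective ((hf (f z) h3.reachNC h4.reachNC).trans (dualPerm_dualPerm hρ hK h5))

end Permutations

/-! ### Characterization of the edges of the poset -/

/-- The discrete partition. -/
def discreteNC (m : ℕ) : NC m :=
  ⟨⊥, fun _ _ _ _ hab hbc _ h _ => absurd (show _ = _ from h) (hab.trans hbc).ne⟩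

/-- The partition with one block. -/
def indiscreteNC (m : ℕ) : NC m := ⟨⊤, fun _ _ _ _ _ _ _ _ _ => trivial⟩

/-- Every block of `z` that contains an element not below `k` contains, with each of its
elements `i ≤ l`, all the elements of `[i, l]` not below `k`. -/
def ConvexAbove {m : ℕ} (k : ℕ) (z : NC m) : Prop :=
  ∀ i j l : Fin m, i ≤ j → j ≤ l → k ≤ (j : ℕ) → z.1 i l → z.1 j l

/-- The covering relations with label other than `k` between partitions that are convex above
`k`. -/
def ConvexEdge {m : ℕ} (k : ℕ) (σ τ : NC m) : Prop :=
  (∃ a b, IsSplit σ τ a b ∧ (a : ℕ) + 1 ≠ k) ∧ ConvexAbove k σ ∧ ConvexAbove k τ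

theorem sum_castSucc_sub_succ (n : ℕ) (g : Fin (n + 1) → ℤ) :
    ∑ i : Fin n, (g i.castSucc - g i.succ) = g 0 - g (Fin.last n) := by
  induction n with
  | zero => simp
  | succ n ih =>
    have := ih fun i => g i.castSucc
    rw [Fin.sum_univ_castSucc]
    simp only [Fin.succ_castSucc, Fin.succ_last] at this ⊢
    rw [this]
    simp

/-- A property that holds at the end of a chain but not at `t` begins to hold at some step. -/
theorem exists_step {n : ℕ} {P : Fin (n + 1) → Prop} {t : Fin (n + 1)} (ht : ¬ P t)
    (hl : P (Fin.last n)) : ∃ s : Fin n, t ≤ s.castSucc ∧ ¬ P s.castSucc ∧ P s.succ := by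
  by_contra! h
  have : ∀ u, t ≤ u → ¬ P u := by
    intro u
    induction u using Fin.induction with
    | zero =>
      intro hu
      rwa [← le_antisymm hu (Fin.zero_le t)]
    | succ i ih =>
      intro hu
      rcases hu.lt_or_eq with h1 | h1
      · have h2 : t ≤ i.castSucc := Fin.le_castSucc_iff.2 h1
        exact h i h2 (ih h2)
      · rwa [← h1]
  exact this _ (Fin.le_last t) hl

section Count

variable {n : ℕ} {c : Fin (n + 1) → NC (n + 1)} {a b : Fin n → Fin (n + 1)}

open Classical in
/-- At most `n - j` steps of a maximal chain can join two blocks that both meet `[j, n]`: each of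
them lowers the number of blocks of the restriction to `[j, n]`. -/
theorem card_joining_steps_le
    (hc : ∀ i : Fin n, IsSplit (c i.castSucc) (c i.succ) (a i) (b i)) (j : Fin (n + 1)) :
    (Finset.univ.filter fun i : Fin n => ∃ x y, j ≤ x ∧ j ≤ y ∧ (c i.succ).1 x y ∧
      ¬ (c i.castSucc).1 x y).card + j ≤ n := by
  set D := Finset.univ.filter fun i : Fin n => ∃ x y, j ≤ x ∧ j ≤ y ∧ (c i.succ).1 x y ∧
      ¬ (c i.castSucc).1 x y with hD
  let g : Fin (n + 1) → ℕ := fun t =>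
    numClasses ((c t).1.comap (Subtype.val : {i : Fin (n + 1) // j ≤ i} → Fin (n + 1)))
  have hg : ∀ i : Fin n, g i.succ ≤ g i.castSucc := fun i =>
    numClasses_le_of_le fun x y hxy => (hc i).le hxy
  have hgD : ∀ i ∈ D, g i.succ < g i.castSucc := by
    intro i hi
    obtain ⟨x, y, hx, hy, h1, h2⟩ := (Finset.mem_filter.1 hi).2
    exact numClasses_lt_of_le (fun x y hxy => (hc i).le hxy) (a := ⟨x, hx⟩) (b := ⟨y, hy⟩) h1 h2
  have hg0 : g 0 ≤ n + 1 - j := by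
    refine (Nat.card_le_card_of_surjective _ Quotient.mk_surjective).trans ?_
    rw [Nat.card_eq_fintype_card, Fintype.card_subtype]
    have : (Finset.univ.filter fun i : Fin (n + 1) => j ≤ i) = Finset.Ici j := by
      ext; simp
    rw [this, Fin.card_Ici]
  have hgl : 1 ≤ g (Fin.last n) := by
    have : Nonempty {i : Fin (n + 1) // j ≤ i} := ⟨⟨j, le_rfl⟩⟩
    exact Nat.card_pos
  have hs := sum_castSucc_sub_succ n fun i => (g i : ℤ)
  have hDs : (D.card : ℤ) ≤ ∑ i : Fin n, ((g i.castSucc : ℤ) - g i.succ) := by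
    rw [Finset.card_eq_sum_ones, Nat.cast_sum]
    refine (Finset.sum_le_sum fun i hi => ?_).trans
      (Finset.sum_le_sum_of_subset_of_nonneg (Finset.subset_univ D) fun i _ _ => ?_)
    · have := hgD i hi
      push_cast
      omega
    · have := hg i
      omega
  have hj := j.2
  omega

/-- If all labels above `k` occur, then a step that joins two blocks meeting `[j, n]`, where
`k ≤ j`, has a label above `j`. -/
theorem le_of_joining_step
    (hc : ∀ i : Fin n, IsSplit (c i.castSucc) (c i.succ) (a i) (b i)) {k : ℕ}
    (hk : ∀ l, k ≤ l → l < n → ∃ i, (a i : ℕ) = l) {j : Fin (n + 1)} (hkj : k ≤ j)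
    {s : Fin n} {x y : Fin (n + 1)} (hx : j ≤ x) (hy : j ≤ y) (h1 : (c s.succ).1 x y)
    (h2 : ¬ (c s.castSucc).1 x y) : j ≤ a s := by
  classical
  by_contra h3
  have h4 := card_joining_steps_le hc j
  set D := Finset.univ.filter fun i : Fin n => ∃ x y, j ≤ x ∧ j ≤ y ∧ (c i.succ).1 x y ∧
      ¬ (c i.castSucc).1 x y with hD
  have h5 : insert s (Finset.univ.filter fun i : Fin n => j ≤ a i) ⊆ D := by
    intro i hi
    rw [hD, Finset.mem_filter]
    rcases Finset.mem_insert.1 hi with rfl | hi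
    · exact ⟨Finset.mem_univ _, x, y, hx, hy, h1, h2⟩
    · have hi' := (Finset.mem_filter.1 hi).2
      exact ⟨Finset.mem_univ _, a i, b i, hi', hi'.trans (hc i).1.le, (hc i).2.1, (hc i).not_rel⟩
  have h6 := Finset.card_le_card h5
  rw [Finset.card_insert_of_notMem (by simp [h3])] at h6
  have h7 : (Finset.Ico (j : ℕ) n) ⊆
      (Finset.univ.filter fun i : Fin n => j ≤ a i).image fun i => (a i : ℕ) := by
    intro l hl
    obtain ⟨h8, h9⟩ := Finset.mem_Ico.1 hl
    obtain ⟨i, hi⟩ := hk l (hkj.trans h8) h9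
    exact Finset.mem_image.2 ⟨i, Finset.mem_filter.2 ⟨Finset.mem_univ _, by
      rw [Fin.le_def, hi]
      exact h8⟩, hi⟩
  have h8 := (Finset.card_le_card h7).trans Finset.card_image_le
  rw [Nat.card_Ico] at h8
  have := j.2
  omega

theorem chain_mono (hc : ∀ i : Fin n, IsSplit (c i.castSucc) (c i.succ) (a i) (b i)) :
    Monotone c := Fin.monotone_iff_le_succ.2 fun i => (hc i).le

/-- If `i ≤ j ≤ l` and `i` is related to `l` but `j` is not, the later step which joins `j` to `l`
is the inverse of a cut at some `(a, b]` with `a < j`, because the block of `l` contains `i`. This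
contradicts `le_of_joining_step`. -/
theorem convexAbove_of_chain (hl : (c (Fin.last n)).1 = ⊤)
    (hc : ∀ i : Fin n, IsSplit (c i.castSucc) (c i.succ) (a i) (b i)) {k : ℕ}
    (hk : ∀ l, k ≤ l → l < n → ∃ i, (a i : ℕ) = l) (t : Fin (n + 1)) :
    ConvexAbove k (c t) := by
  intro i j l hij hjl hkj hil
  by_contra hjl'
  obtain ⟨s, hs, h1, h2⟩ := exists_step (P := fun u => (c u).1 j l) hjl' (by rw [hl]; trivial)
  have h3 := le_of_joining_step hc hk hkj le_rfl hjl h2 h1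
  have h4 : (c s.castSucc).1 i l := (show c t ≤ c s.castSucc from chain_mono hc hs) hil
  rcases (hc s).rel_cases h2 with h5 | ⟨h5, h6⟩ | ⟨h5, h6⟩
  · exact h1 h5
  · have := ((hc s).rel_right.1 ((c s.castSucc).1.trans h4 h6)).2
    omega
  · have := ((hc s).rel_right.1 h5).2
    omega

/-- The labels of a maximal chain form a parking function: by `card_joining_steps_le`, at most
`n - j` of them exceed `j`. -/
theorem isParkingFunction_of_chain
    (hc : ∀ i : Fin n, IsSplit (c i.castSucc) (c i.succ) (a i) (b i)) :
    IsParkingFunction fun i => (a i : ℕ) + 1 := by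
  classical
  refine ⟨fun i => Nat.le_add_left 1 _, Tuple.sort fun i => (a i : ℕ) + 1,
    Tuple.monotone_sort fun i => (a i : ℕ) + 1, fun i => ?_⟩
  set f := fun i => (a i : ℕ) + 1 with hf
  set s := Tuple.sort f with hs
  have hm : Monotone (f ∘ s) := Tuple.monotone_sort _
  by_contra! hi
  have hin := i.2
  let j : Fin (n + 1) := ⟨i + 1, by omega⟩
  have h1 := card_joining_steps_le hc j
  have h2 : (Finset.Ici i).map s.toEmbedding ⊆
      Finset.univ.filter fun i : Fin n => ∃ x y, j ≤ x ∧ j ≤ y ∧ (c i.succ).1 x y ∧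
      ¬ (c i.castSucc).1 x y := by
    intro u hu
    obtain ⟨v, hv, rfl⟩ := Finset.mem_map.1 hu
    have h3 : f (s i) ≤ f (s v) := hm (Finset.mem_Ici.1 hv)
    have h4 : j ≤ a (s v) := by
      rw [Fin.le_def]
      simp only [j, hf] at h3 hi ⊢
      omega
    exact Finset.mem_filter.2 ⟨Finset.mem_univ _, a (s v), b (s v), h4, h4.trans (hc _).1.le,
      (hc _).2.1, (hc _).not_rel⟩
  have h3 := Finset.card_le_card h2
  rw [Finset.card_map, Fin.card_Ici] at h3
  have h4 : (j : ℕ) = i + 1 := rfl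
  omega

end Count

theorem convexEdge_of_mem_PFChains {n k : ℕ} {c : Fin (n + 1) → NC (n + 1)}
    (hc : c ∈ PFChains n k) (i : Fin n) : ConvexEdge k (c i.castSucc) (c i.succ) := by
  obtain ⟨⟨h0, hl, hcov⟩, a, ⟨-, ha, ha'⟩, hlab⟩ := hc
  choose a' b' hab using fun i => (hlab i).exists_isSplit (hcov i)
  have hs := fun i => (hab i).2
  have hk : ∀ l, k ≤ l → l < n → ∃ i, (a' i : ℕ) = l := by
    intro l h1 h2
    obtain ⟨i, hi⟩ := ha' (l + 1) (by omega) (by omega)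
    have := (hab i).1
    exact ⟨i, by omega⟩
  refine ⟨⟨a' i, b' i, hs i, ?_⟩, convexAbove_of_chain hl hs hk _,
    convexAbove_of_chain hl hs hk _⟩
  rw [← (hab i).1]
  exact ha i

theorem reach_of_mem_PFChains {n k : ℕ} {c : Fin (n + 1) → NC (n + 1)}
    (hc : c ∈ PFChains n k) (i : Fin (n + 1)) :
    Relation.ReflTransGen (ConvexEdge k) (discreteNC _) (c i) ∧
      Relation.ReflTransGen (ConvexEdge k) (c i) (indiscreteNC _) := by
  have h0 : c 0 = discreteNC _ := Subtype.ext hc.1.1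
  have hl : c (Fin.last n) = indiscreteNC _ := Subtype.ext hc.1.2.1
  constructor
  · induction i using Fin.induction with
    | zero => rw [h0]
    | succ i ih => exact ih.tail (convexEdge_of_mem_PFChains hc i)
  · induction i using Fin.reverseInduction with
    | last => rw [hl]
    | cast i ih => exact ih.head (convexEdge_of_mem_PFChains hc i)

/-- A path whose steps raise a rank function by one, indexed by rank. -/
theorem exists_path {α : Type*} {r : α → α → Prop} {ρ : α → ℕ} (hρ : ∀ x y, r x y → ρ y = ρ x + 1)
    {x y : α} (h : Relation.ReflTransGen r x y) :
    ∃ c : ℕ → α, c (ρ x) = x ∧ c (ρ y) = y ∧ ∀ i, ρ x ≤ i → i < ρ y → r (c i) (c (i + 1)) := by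
  classical
  induction h with
  | refl => exact ⟨fun _ => x, rfl, rfl, fun i h1 h2 => absurd h2 (not_lt.2 h1)⟩
  | @tail v w hv hw ih =>
    obtain ⟨c, h1, h2, h3⟩ := ih
    have h4 := hρ _ _ hw
    have h5 : ρ x ≤ ρ v := by
      clear h1 h2 h3 h4 hw
      induction hv with
      | refl => exact le_rfl
      | tail _ h ih => exact ih.trans (by rw [hρ _ _ h]; omega)
    refine ⟨Function.update c (ρ w) w, ?_, by simp, fun i h6 h7 => ?_⟩
    · rw [Function.update_of_ne (by omega), h1]
    · rw [Function.update_of_ne (by omega)]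
      by_cases h8 : i + 1 = ρ w
      · rw [h8, Function.update_self]
        have : i = ρ v := by omega
        rw [this, h2]
        exact hw
      · rw [Function.update_of_ne h8]
        exact h3 i h6 (by omega)

theorem numClasses_discreteNC (m : ℕ) : numClasses (discreteNC m).1 = m := by
  rw [numClasses]
  conv_rhs => rw [← Nat.card_fin m]
  exact Nat.card_congr (Equiv.ofBijective (Quotient.mk _) ⟨fun i j h => Quotient.exact h,
    Quotient.mk_surjective⟩).symm

theorem numClasses_indiscreteNC (n : ℕ) : numClasses (indiscreteNC (n + 1)).1 = 1 := by
  rw [numClasses, Nat.card_eq_one_iff_unique]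
  exact ⟨⟨fun p q => Quotient.inductionOn₂ p q fun i j => Quotient.sound trivial⟩,
    ⟨Quotient.mk _ 0⟩⟩

/-- Every label above `k` occurs on a maximal chain of convex edges. -/
theorem mem_PFChains_of_convexEdge {n k : ℕ} (hk : 1 ≤ k) {c : Fin (n + 1) → NC (n + 1)}
    (h0 : (c 0).1 = ⊥) (hl : (c (Fin.last n)).1 = ⊤)
    (hc : ∀ i : Fin n, ConvexEdge k (c i.castSucc) (c i.succ)) : c ∈ PFChains n k := by
  choose a b hs hak using fun i => (hc i).1
  refine ⟨⟨h0, hl, fun i => (hs i).covBy⟩, fun i => (a i : ℕ) + 1,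
    ⟨isParkingFunction_of_chain hs, hak, fun j hkj hjn => ?_⟩, fun i => (hs i).isEdgeLabel⟩
  -- the label of the step which joins the neighbours `j - 1` and `j`
  let x : Fin (n + 1) := ⟨j - 1, by omega⟩
  let y : Fin (n + 1) := ⟨j, by omega⟩
  have hx : (x : ℕ) = j - 1 := rfl
  have hy : (y : ℕ) = j := rfl
  obtain ⟨s, -, h1, h2⟩ := exists_step (P := fun u => (c u).1 x y) (t := 0) (by
    rw [h0]
    intro h
    have h : x = y := h
    have := congrArg Fin.val h
    omega) (by rw [hl]; trivial)
  refine ⟨s, ?_⟩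
  rcases (hs s).rel_cases h2 with h5 | ⟨h5, h6⟩ | ⟨h5, h6⟩
  · exact absurd h5 h1
  · have h7 := ((hs s).rel_left.1 h5).2
    have h8 := ((hs s).rel_right.1 h6).2
    simp only [Fin.lt_def, Fin.le_def] at h7 h8
    show ((a s : Fin (n + 1)) : ℕ) + 1 = j
    omega
  · have h7 := ((hs s).rel_right.1 h5).2
    have h8 := (hc s).2.1 (a s) x y h7.1.le (by rw [Fin.le_def]; omega) (by omega)
      ((c s.castSucc).1.symm h6)
    exact absurd h8 h1

/-- The maximal chain through the edge is indexed by rank, `n + 1` minus the number of blocks. -/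
theorem PFEdge_of_convexEdge {n k : ℕ} (hk : 1 ≤ k) {σ τ : NC (n + 1)}
    (h1 : Relation.ReflTransGen (ConvexEdge k) (discreteNC _) σ) (h : ConvexEdge k σ τ)
    (h2 : Relation.ReflTransGen (ConvexEdge k) τ (indiscreteNC _)) : PFEdge n k σ τ := by
  set ρ : NC (n + 1) → ℕ := fun z => n + 1 - numClasses z.1 with hρ
  have hr : ∀ x y : NC (n + 1), ConvexEdge k x y → ρ y = ρ x + 1 := by
    rintro x y ⟨⟨a, b, hs, -⟩, -⟩
    have h3 := hs.numClasses_eq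
    have h4 : numClasses x.1 ≤ n + 1 := by
      refine (Nat.card_le_card_of_surjective _ Quotient.mk_surjective).trans ?_
      rw [Nat.card_fin]
    simp only [hρ]
    omega
  obtain ⟨c, hc0, hcσ, hc⟩ := exists_path hr h1
  obtain ⟨d, hdτ, hdl, hd⟩ := exists_path hr h2
  have hρ0 : ρ (discreteNC _) = 0 := by simp [hρ, numClasses_discreteNC]
  have hρl : ρ (indiscreteNC _) = n := by simp [hρ, numClasses_indiscreteNC]
  have hστ := hr _ _ h
  have hτn : ρ τ ≤ n := by
    have : numClasses τ.1 ≠ 0 := (Nat.card_pos (α := Quotient τ.1)).ne'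
    simp only [hρ]
    omega
  rw [hρ0] at hc0 hc
  rw [hρl] at hdl hd
  let e : ℕ → NC (n + 1) := fun i => if i ≤ ρ σ then c i else d i
  have he : ∀ i, i < n → ConvexEdge k (e i) (e (i + 1)) := by
    intro i hi
    rcases lt_trichotomy i (ρ σ) with h3 | h3 | h3
    · simp only [e, if_pos h3.le, if_pos (Nat.succ_le_of_lt h3)]
      exact hc i (Nat.zero_le _) h3
    · subst h3
      simp only [e, le_refl, if_true, Nat.not_succ_le_self, if_false]
      rw [hcσ, ← hστ, hdτ]
      exact h
    · have h4 : ¬ i ≤ ρ σ := by omega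
      have h5 : ¬ i + 1 ≤ ρ σ := by omega
      simp only [e, if_neg h4, if_neg h5]
      exact hd i (by omega) hi
  refine ⟨fun i => e i, mem_PFChains_of_convexEdge hk ?_ ?_ fun i => he i i.2, ⟨ρ σ, by omega⟩, ?_, ?_⟩
  · simp [e, hc0, discreteNC]
  · have : ¬ n ≤ ρ σ := by omega
    simp [e, this, hdl, indiscreteNC]
  · simp [e, hcσ]
  · have : ¬ ρ σ + 1 ≤ ρ σ := by omega
    simp only [e, Fin.val_succ, if_neg this]
    rw [← hστ, hdτ]

theorem PFEdge_iff {n k : ℕ} (hk : 1 ≤ k) {σ τ : NC (n + 1)} :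
    PFEdge n k σ τ ↔ Relation.ReflTransGen (ConvexEdge k) (discreteNC _) σ ∧ ConvexEdge k σ τ ∧
      Relation.ReflTransGen (ConvexEdge k) τ (indiscreteNC _) := by
  refine ⟨?_, fun h => PFEdge_of_convexEdge hk h.1 h.2.1 h.2.2⟩
  rintro ⟨c, hc, i, rfl, rfl⟩
  exact ⟨(reach_of_mem_PFChains hc _).1, convexEdge_of_mem_PFChains hc i,
    (reach_of_mem_PFChains hc _).2⟩

/-! ### Product decomposition -/

/-- The restriction of `z` to `[0, k]`, the larger elements being made singletons. -/
def restrictTo {m : ℕ} (k : ℕ) (z : NC m) : NC m :=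
  ⟨{ r := fun i l => i = l ∨ ((i : ℕ) ≤ k ∧ (l : ℕ) ≤ k ∧ z.1 i l)
     iseqv := by
      refine ⟨fun i => Or.inl rfl, ?_, ?_⟩
      · rintro i l (h | ⟨h1, h2, h3⟩)
        · exact Or.inl h.symm
        · exact Or.inr ⟨h2, h1, z.1.symm h3⟩
      · rintro i j l (rfl | ⟨h1, h2, h3⟩) (rfl | ⟨h4, h5, h6⟩)
        · exact Or.inl rfl
        · exact Or.inr ⟨h4, h5, h6⟩
        · exact Or.inr ⟨h1, h2, h3⟩
        · exact Or.inr ⟨h1, h5, z.1.trans h3 h6⟩ }, by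
    intro i j l r hij hjl hlr h1 h2
    rcases h1 with h1 | ⟨h1, h3, h4⟩
    · omega
    rcases h2 with h2 | ⟨h2, h5, h6⟩
    · omega
    exact Or.inr ⟨h1, h2, z.2 i j l r hij hjl hlr h4 h6⟩⟩

theorem restrictTo_iff {m k : ℕ} {z : NC m} {i l : Fin m} :
    (restrictTo k z).1 i l ↔ i = l ∨ ((i : ℕ) ≤ k ∧ (l : ℕ) ≤ k ∧ z.1 i l) := Iff.rfl

/-- The elements beyond `k` that are not minimal in their block. For `z` convex above `k` these are
the `l > k` which are in one block with `l - 1`. -/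
def nonminAbove {m : ℕ} (k : ℕ) (z : NC m) : Set (Fin m) :=
  {l | k < (l : ℕ) ∧ ∃ j, j < l ∧ z.1 j l}

/-- All nontrivial blocks of `w` lie in `[0, k]`. -/
def SupportedOn {m : ℕ} (k : ℕ) (w : NC m) : Prop := ∀ i j, w.1 i j → i ≠ j → (i : ℕ) ≤ k

theorem supportedOn_restrictTo {m k : ℕ} (z : NC m) : SupportedOn k (restrictTo k z) := by
  rintro i j (h | h) hne
  · exact absurd h hne
  · exact h.1

theorem SupportedOn.anti {m k : ℕ} {v w : NC m} (h : SupportedOn k w) (hvw : v ≤ w) :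
    SupportedOn k v := fun i j hij hne => h i j (hvw hij) hne

/-- A partition that is convex above `k` is determined by its restriction to `[0, k]` and the
elements beyond `k` that are not minimal in their block. -/
theorem le_of_restrictTo_le {m k : ℕ} {x y : NC m} (hx : ConvexAbove k x) (hy : ConvexAbove k y)
    (h : restrictTo k x ≤ restrictTo k y) (hJ : nonminAbove k x ⊆ nonminAbove k y) : x ≤ y := by
  have key : ∀ (N : ℕ) (i l : Fin m), (l : ℕ) = N → i ≤ l → x.1 i l → y.1 i l := by
    intro N
    induction N with
    | zero =>
      intro i l hl hil hx
      have : i = l := by omega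
      rw [this]
    | succ N ih =>
      intro i l hl hil hxil
      rcases hil.lt_or_eq with hil' | rfl
      swap
      · exact y.1.refl i
      by_cases hlk : (l : ℕ) ≤ k
      · rcases h (Or.inr ⟨(Fin.le_def.1 hil).trans hlk, hlk, hxil⟩ : (restrictTo k x).1 i l)
          with h1 | h1
        · exact absurd h1 hil'.ne
        · exact h1.2.2
      · obtain ⟨-, j, hjl, hj⟩ := hJ ⟨not_le.1 hlk, i, hil', hxil⟩
        let l' : Fin m := ⟨N, by omega⟩
        have hl' : (l' : ℕ) = N := rfl
        have h1 := hy j l' l (by omega) (by omega) (by omega) hj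
        have h2 := hx i l' l (by omega) (by omega) (by omega) hxil
        exact y.1.trans (ih i l' hl' (by omega) (x.1.trans hxil (x.1.symm h2))) h1
  intro i l hil
  rcases le_total i l with h1 | h1
  · exact key _ i l rfl h1 hil
  · exact y.1.symm (key _ l i rfl h1 (x.1.symm hil))

section Root

variable {n : ℕ}

open Classical in
/-- The greatest element up to `i` that is not in `S`. -/
noncomputable def root (S : Set (Fin (n + 1))) (i : Fin (n + 1)) : Fin (n + 1) :=
  (Finset.univ.filter fun j => j ≤ i ∧ j ∉ S).sup id

variable {S : Set (Fin (n + 1))} {i j : Fin (n + 1)}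

theorem root_le : root S i ≤ i := by
  classical
  exact Finset.sup_le fun _ hj => (Finset.mem_filter.1 hj).2.1

theorem le_root (hj : j ≤ i) (hS : j ∉ S) : j ≤ root S i := by
  classical
  exact Finset.le_sup (f := id) (Finset.mem_filter.2 ⟨Finset.mem_univ _, hj, hS⟩)

theorem root_mono : Monotone (root S) := fun _ _ h => by
  classical
  refine Finset.sup_mono fun l hl => ?_
  simp only [Finset.mem_filter, Finset.mem_univ, true_and] at hl ⊢
  exact ⟨hl.1.trans h, hl.2⟩

theorem root_notMem (h0 : 0 ∉ S) : root S i ∉ S := by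
  classical
  obtain ⟨l, hl, h⟩ := Finset.exists_mem_eq_sup (Finset.univ.filter fun j => j ≤ i ∧ j ∉ S)
    ⟨0, by simp [h0]⟩ id
  rw [root, h]
  exact (Finset.mem_filter.1 hl).2.2

theorem root_of_notMem (h : i ∉ S) : root S i = i := le_antisymm root_le (le_root le_rfl h)

theorem mem_of_root_lt (h : root S i < j) (hj : j ≤ i) : j ∈ S := by
  by_contra h'
  exact absurd (le_root hj h') (not_le.2 h)

theorem root_eq (h0 : 0 ∉ S) (hj : j ≤ i) (hS : j ∉ S) (h : ∀ l, j < l → l ≤ i → l ∈ S) :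
    root S i = j := by
  refine le_antisymm ?_ (le_root hj hS)
  by_contra! h'
  exact root_notMem h0 (h _ h' root_le)

/-- The partition that arises from `w` by attaching each element of `S` to the block of its
predecessor. -/
noncomputable def attach (w : NC (n + 1)) (S : Set (Fin (n + 1))) : NC (n + 1) :=
  ⟨w.1.comap (root S), by
    intro i j l r hij hjl hlr h1 h2
    have h1 : w.1 (root S i) (root S l) := h1
    have h2 : w.1 (root S j) (root S r) := h2
    show w.1 (root S i) (root S j)
    rcases (root_mono (S := S) hij.le).lt_or_eq with h3 | h3
    swap
    · rw [h3]
    rcases (root_mono (S := S) hjl.le).lt_or_eq with h4 | h4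
    swap
    · rwa [h4]
    rcases (root_mono (S := S) hlr.le).lt_or_eq with h5 | h5
    swap
    · exact w.1.trans h1 (w.1.symm (h5 ▸ h2))
    exact w.2 _ _ _ _ h3 h4 h5 h1 h2⟩

theorem attach_iff {w : NC (n + 1)} : (attach w S).1 i j ↔ w.1 (root S i) (root S j) := Iff.rfl

variable {k : ℕ} {w w' : NC (n + 1)}

theorem zero_notMem (hS : ∀ i ∈ S, k < (i : ℕ)) : 0 ∉ S := fun h => absurd (hS 0 h) (by simp)

theorem root_of_le (hS : ∀ i ∈ S, k < (i : ℕ)) (hi : (i : ℕ) ≤ k) : root S i = i :=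
  root_of_notMem fun h => absurd (hS i h) (not_lt.2 hi)

theorem convexAbove_attach (hw : SupportedOn k w) (hS : ∀ i ∈ S, k < (i : ℕ)) :
    ConvexAbove k (attach w S) := by
  intro i j l hij hjl hkj hil
  rw [attach_iff] at hil ⊢
  have h1 : root S i ≤ root S j := root_mono hij
  have h2 : root S j ≤ root S l := root_mono hjl
  by_cases h : root S i = root S l
  · rw [le_antisymm h2 (h ▸ h1)]
  · have h3 := hw _ _ (w.1.symm hil) (Ne.symm h)
    let K : Fin (n + 1) := ⟨k, by omega⟩
    have h4 : K ≤ root S j := le_root (Fin.le_def.2 hkj) fun h => absurd (hS K h) (lt_irrefl k)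
    have h5 : k ≤ (root S j : ℕ) := h4
    have : root S j = root S l := by omega
    rw [this]

theorem restrictTo_attach (hw : SupportedOn k w) (hS : ∀ i ∈ S, k < (i : ℕ)) :
    restrictTo k (attach w S) = w := by
  refine Subtype.ext (Setoid.ext fun i l => ?_)
  change (restrictTo k (attach w S)).1 i l ↔ _
  rw [restrictTo_iff, attach_iff]
  constructor
  · rintro (rfl | ⟨h1, h2, h3⟩)
    · exact w.1.refl i
    · rwa [root_of_le hS h1, root_of_le hS h2] at h3
  · intro h
    by_cases hil : i = l
    · exact Or.inl hil
    · have h1 := hw _ _ h hil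
      have h2 := hw _ _ (w.1.symm h) (Ne.symm hil)
      exact Or.inr ⟨h1, h2, by rwa [root_of_le hS h1, root_of_le hS h2]⟩

theorem nonminAbove_attach (hw : SupportedOn k w) (hS : ∀ i ∈ S, k < (i : ℕ)) :
    nonminAbove k (attach w S) = S := by
  ext l
  constructor
  · rintro ⟨h1, j, hj, h2⟩
    by_contra hl
    rw [attach_iff, root_of_notMem hl] at h2
    have h3 : root S j < l := root_le.trans_lt hj
    have := hw _ _ (w.1.symm h2) h3.ne'
    omega
  · intro hl
    have h0 := root_notMem (i := l) (zero_notMem hS)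
    refine ⟨hS l hl, root S l, lt_of_le_of_ne root_le fun h => h0 (by rwa [h]), ?_⟩
    rw [attach_iff, root_of_notMem h0]

theorem attach_restrictTo {z : NC (n + 1)} (hz : ConvexAbove k z) :
    attach (restrictTo k z) (nonminAbove k z) = z := by
  have hS : ∀ i ∈ nonminAbove k z, k < (i : ℕ) := fun i hi => hi.1
  have hw := supportedOn_restrictTo (k := k) z
  have h1 := convexAbove_attach hw hS
  have h2 := restrictTo_attach hw hS
  have h3 := nonminAbove_attach hw hS
  exact le_antisymm (le_of_restrictTo_le h1 hz h2.le h3.le) (le_of_restrictTo_le hz h1 h2.ge h3.ge)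

theorem exists_root_le_iff (S : Set (Fin (n + 1))) (b : Fin (n + 1)) :
    ∃ b', b ≤ b' ∧ ∀ i, root S i ≤ b ↔ i ≤ b' := by
  obtain ⟨b', hb, hb'⟩ := (Set.toFinite {i | root S i ≤ b}).exists_le_maximal
    (show b ∈ {i | root S i ≤ b} from root_le)
  refine ⟨b', hb, fun i => ⟨fun h => ?_, fun h => (root_mono h).trans hb'.1⟩⟩
  rcases le_total i b' with h1 | h1
  · exact h1
  · exact hb'.2 h h1

/-- The cut of `w'` at `(a, b]` lifts to the cut at `(a, b']`, where `b'` is the last element that is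
attached to the block of some element up to `b`. -/
theorem convexEdge_attach (hw : SupportedOn k w') (hS : ∀ i ∈ S, k < (i : ℕ)) {a b : Fin (n + 1)}
    (h : IsSplit w w' a b) (ha : (a : ℕ) + 1 ≠ k) : ConvexEdge k (attach w S) (attach w' S) := by
  refine ⟨?_, convexAbove_attach (hw.anti h.le) hS, convexAbove_attach hw hS⟩
  have hab := h.1
  have hbk := hw b a (w'.1.symm h.2.1) hab.ne'
  obtain ⟨b', hb, hb'⟩ := exists_root_le_iff S b
  have hra : root S a = a := root_of_le hS (by omega)
  have hrb : root S b' = b := le_antisymm ((hb' b').2 le_rfl) (by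
    have := root_mono (S := S) hb
    rwa [root_of_le hS hbk] at this)
  refine ⟨a, b', ⟨hab.trans_le hb, ?_, fun i j => ?_⟩, ha⟩
  · rw [attach_iff, hra, hrb]
    exact h.2.1
  · have hlt : ∀ i, a < root S i ↔ a < i := by
      refine fun i => ⟨fun h1 => h1.trans_le root_le, fun h1 => ?_⟩
      let a' : Fin (n + 1) := ⟨a + 1, by omega⟩
      have h2 : a' ≤ root S i := le_root (Fin.le_def.2 h1) fun h3 => by
        have h4 : k < (a : ℕ) + 1 := hS a' h3
        omega
      exact lt_of_lt_of_le (Fin.lt_def.2 (Nat.lt_succ_self _)) h2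
    rw [attach_iff, attach_iff, attach_iff, h.2.2, hra, hlt, hlt, hb', hb']

theorem root_insert_of_ne {l : Fin (n + 1)} (hS : 0 ∉ insert l S) (h : root S i ≠ l) :
    root (insert l S) i = root S i := by
  have h0 : 0 ∉ S := fun h0 => hS (Or.inr h0)
  refine root_eq hS root_le ?_ fun j h1 h2 => Or.inr (mem_of_root_lt h1 h2)
  rintro (h1 | h1)
  · exact h h1
  · exact root_notMem h0 h1

theorem root_insert_of_eq {l l' : Fin (n + 1)} (hS : 0 ∉ insert l S) (hl : (l' : ℕ) + 1 = l)
    (h : root S i = l) : root (insert l S) i = root S l' := by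
  have h0 : 0 ∉ S := fun h0 => hS (Or.inr h0)
  have h1 : root S l' ≤ l' := root_le
  have h2 : root S i ≤ i := root_le
  refine root_eq hS (by omega) ?_ fun j h3 h4 => ?_
  · rintro (h3 | h3)
    · omega
    · exact root_notMem h0 h3
  · rcases lt_trichotomy j l with h5 | rfl | h5
    · exact Or.inr (mem_of_root_lt h3 (by omega))
    · exact Or.inl rfl
    · exact Or.inr (mem_of_root_lt (h ▸ h5) h4)

/-- The run of elements with root `l` is joined to its predecessor, by a step whose label is `l`. -/
theorem convexEdge_attach_insert (hw : SupportedOn k w) (hS : ∀ i ∈ S, k < (i : ℕ))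
    {l : Fin (n + 1)} (hl : k < (l : ℕ)) (hlS : l ∉ S) :
    ConvexEdge k (attach w S) (attach w (insert l S)) := by
  have hS' : ∀ i ∈ insert l S, k < (i : ℕ) := by
    rintro i (rfl | hi)
    · exact hl
    · exact hS i hi
  have h0 := zero_notMem hS'
  refine ⟨?_, convexAbove_attach hw hS, convexAbove_attach hw hS'⟩
  let a : Fin (n + 1) := ⟨l - 1, by omega⟩
  have ha : (a : ℕ) + 1 = l := by simp only [a]; omega
  obtain ⟨b', hb, hb'⟩ := exists_root_le_iff S l
  have hP : ∀ i, (a < i ∧ i ≤ b') ↔ root S i = l := by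
    intro i
    rw [← hb']
    constructor
    · rintro ⟨h1, h2⟩
      exact le_antisymm h2 (le_root (by omega) hlS)
    · intro h
      have : root S i ≤ i := root_le
      exact ⟨by omega, h.le⟩
  have hra : root (insert l S) a = root S a := root_insert_of_ne h0 (by
    have : root S a ≤ a := root_le
    omega)
  have hb2 := (hP b').1 ⟨by omega, le_rfl⟩
  refine ⟨a, b', ⟨by omega, ?_, fun i j => ?_⟩, by omega⟩
  · rw [attach_iff, hra, root_insert_of_eq h0 ha hb2]
  · rw [attach_iff, attach_iff, attach_iff, hP, hP, hra]
    by_cases hi : root S i = l <;> by_cases hj : root S j = l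
    · rw [root_insert_of_eq h0 ha hi, root_insert_of_eq h0 ha hj, hi, hj]
      simp
    · rw [root_insert_of_eq h0 ha hi, hi]
      have : ¬ w.1 l (root S j) := fun h => absurd (hw _ _ h (Ne.symm hj)) (by omega)
      simp [this, hj]
    · rw [root_insert_of_eq h0 ha hj, hj]
      have : ¬ w.1 (root S i) l := fun h => absurd (hw _ _ (w.1.symm h) (Ne.symm hi)) (by omega)
      simp only [this, hi, false_iff, not_and]
      intro h1 h2
      simpa using h2 h1
    · rw [root_insert_of_ne h0 hi, root_insert_of_ne h0 hj]
      simp [hi, hj]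

/-- Reachability by convex edges. -/
abbrev ConvexReach {m : ℕ} (k : ℕ) : NC m → NC m → Prop := Relation.ReflTransGen (ConvexEdge k)

theorem convexReach_attach {p : Fin (n + 1)} (hp : (p : ℕ) + 1 = k) (hw : SupportedOn k w')
    (hS : ∀ i ∈ S, k < (i : ℕ)) (h : Reach p w w') : ConvexReach k (attach w S) (attach w' S) := by
  induction h with
  | refl => exact .refl
  | tail _ h ih =>
    obtain ⟨a, b, h, ha⟩ := h
    exact (ih (hw.anti h.le)).tail (convexEdge_attach hw hS h (by omega))

theorem convexReach_attach_union (hw : SupportedOn k w) (hS : ∀ i ∈ S, k < (i : ℕ))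
    (T : Set (Fin (n + 1))) (hT : ∀ i ∈ T, k < (i : ℕ)) :
    ConvexReach k (attach w S) (attach w (S ∪ T)) := by
  induction T, T.toFinite using Set.Finite.induction_on with
  | empty => rw [Set.union_empty]
  | @insert l T _ _ ih =>
    have h1 : ∀ i ∈ T, k < (i : ℕ) := fun i hi => hT i (Or.inr hi)
    have h2 : ∀ i ∈ S ∪ T, k < (i : ℕ) := fun i hi => hi.elim (hS i) (h1 i)
    rw [Set.union_insert]
    by_cases h : l ∈ S ∪ T
    · rw [Set.insert_eq_of_mem h]
      exact ih h1
    · exact (ih h1).tail (convexEdge_attach_insert hw h2 (hT l (Or.inl rfl)) h)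

end Root

theorem nonminAbove_mono {m k : ℕ} {σ τ : NC m} (h : σ ≤ τ) :
    nonminAbove k σ ⊆ nonminAbove k τ := fun _ ⟨h1, j, h2, h3⟩ => ⟨h1, j, h2, h h3⟩

theorem ConvexReach.le {m k : ℕ} {σ τ : NC m} (h : ConvexReach k σ τ) : σ ≤ τ := by
  induction h with
  | refl => exact le_rfl
  | tail _ h ih =>
    obtain ⟨⟨a, b, h, -⟩, -⟩ := h
    exact ih.trans h.le

/-- A convex edge with label above `k` is lost in the restriction to `[0, k]`; one with a smaller
label becomes an edge with the same label. -/
theorem ConvexEdge.reach_restrictTo {m k : ℕ} {p : Fin m} (hp : (p : ℕ) + 1 = k) (hkm : k < m)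
    {σ τ : NC m} (h : ConvexEdge k σ τ) : Reach p (restrictTo k σ) (restrictTo k τ) := by
  obtain ⟨⟨a, b, h, ha⟩, hσ, hτ⟩ := h
  have hab := h.1
  by_cases hak : k ≤ (a : ℕ)
  · have : restrictTo k σ = restrictTo k τ := by
      refine Subtype.ext (Setoid.ext fun i l => ?_)
      change (restrictTo k σ).1 i l ↔ (restrictTo k τ).1 i l
      rw [restrictTo_iff, restrictTo_iff, h.2.2]
      refine or_congr_right (and_congr_right fun hi => and_congr_right fun hl => ?_)
      exact and_iff_left fun _ => by omega
    rw [this]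
    exact .refl
  · push Not at hak
    refine .single ?_
    let b' : Fin m := ⟨min (b : ℕ) k, by omega⟩
    have hb' : (b' : ℕ) = min (b : ℕ) k := rfl
    have hab' : τ.1 a b' := by
      by_cases hbk : (b : ℕ) ≤ k
      · have : b' = b := by omega
        rw [this]
        exact h.2.1
      · have := hτ a b' b (by omega) (by omega) (by omega) h.2.1
        exact τ.1.trans h.2.1 (τ.1.symm this)
    refine ⟨a, b', ⟨by omega, Or.inr ⟨hak.le, by omega, hab'⟩, fun i l => ?_⟩, by omega⟩
    rw [restrictTo_iff, restrictTo_iff, restrictTo_iff, h.2.2]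
    by_cases hil : i = l
    · subst hil
      simp
    by_cases hi : (i : ℕ) ≤ k
    swap
    · simp [hil, hi]
    by_cases hl : (l : ℕ) ≤ k
    swap
    · simp [hil, hl]
    have h1 : i ≤ b' ↔ i ≤ b := by omega
    have h2 : l ≤ b' ↔ l ≤ b := by omega
    rw [h1, h2]
    by_cases hia : i = a
    · subst hia
      simp [hil, hi, hl]
    · simp [hil, hi, hl, hia, hak.le]

theorem ConvexReach.reach_restrictTo {m k : ℕ} {p : Fin m} (hp : (p : ℕ) + 1 = k) (hkm : k < m)
    {σ τ : NC m} (h : ConvexReach k σ τ) : Reach p (restrictTo k σ) (restrictTo k τ) := by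
  induction h with
  | refl => exact .refl
  | tail _ h ih => exact Relation.ReflTransGen.trans ih (h.reach_restrictTo hp hkm)

/-- A path between the restrictions lifts to a path that first changes the restriction only, and
then adds the new nonminimal elements one by one. -/
theorem convexReach_of_restrictTo {n k : ℕ} {p : Fin (n + 1)} (hp : (p : ℕ) + 1 = k)
    {x y : NC (n + 1)} (hx : ConvexAbove k x) (hy : ConvexAbove k y)
    (h : Reach p (restrictTo k x) (restrictTo k y)) (hJ : nonminAbove k x ⊆ nonminAbove k y) :
    ConvexReach k x y := by
  have hSx : ∀ i ∈ nonminAbove k x, k < (i : ℕ) := fun i hi => hi.1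
  have hSy : ∀ i ∈ nonminAbove k y, k < (i : ℕ) := fun i hi => hi.1
  have h1 := convexReach_attach hp (supportedOn_restrictTo y) hSx h
  have h2 := convexReach_attach_union (supportedOn_restrictTo y) hSx _ hSy
  rw [Set.union_eq_self_of_subset_left hJ, attach_restrictTo hy] at h2
  rw [attach_restrictTo hx] at h1
  exact h1.trans h2

/-! ### Local self-duality -/

theorem convexAbove_discreteNC (m k : ℕ) : ConvexAbove k (discreteNC m) := by
  intro i j l hij hjl _ h
  have h : i = l := h
  exact show j = l from le_antisymm hjl (h ▸ hij)

theorem ConvexReach.convexAbove {m k : ℕ} {z : NC m} (h : ConvexReach k (discreteNC m) z) :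
    ConvexAbove k z := by
  rcases Relation.ReflTransGen.cases_tail h with h | ⟨_, _, h⟩
  · rw [h]
    exact convexAbove_discreteNC m k
  · exact h.2.2

/-- The hypothesis `1 ≤ n` makes sure that `z` lies on some edge. -/
theorem exists_mem_PFChains {n k : ℕ} (hk : 1 ≤ k) (hn : 1 ≤ n) {z : NC (n + 1)}
    (h : ConvexReach k (discreteNC _) z) (h' : ConvexReach k z (indiscreteNC _)) :
    ∃ c ∈ PFChains n k, ∃ i, c i = z := by
  rcases Relation.ReflTransGen.cases_head h' with rfl | ⟨v, hzv, hv⟩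
  · rcases Relation.ReflTransGen.cases_tail h with h1 | ⟨v, hv, hvz⟩
    · have := congrArg (fun z => numClasses z.1) h1
      simp only [numClasses_indiscreteNC, numClasses_discreteNC] at this
      omega
    · obtain ⟨c, hc, i, -, hi⟩ := PFEdge_of_convexEdge hk hv hvz h'
      exact ⟨c, hc, _, hi⟩
  · obtain ⟨c, hc, i, hi, -⟩ := PFEdge_of_convexEdge hk h hzv hv
    exact ⟨c, hc, _, hi⟩

namespace PosetPF

variable {n k : ℕ}

theorem convexReach_val (x : PosetPF n k) : ConvexReach k (discreteNC _) x.val := by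
  obtain ⟨c, hc, i, hi⟩ := x.mem_chain
  exact hi ▸ (reach_of_mem_PFChains hc i).1

theorem val_convexReach (x : PosetPF n k) : ConvexReach k x.val (indiscreteNC _) := by
  obtain ⟨c, hc, i, hi⟩ := x.mem_chain
  exact hi ▸ (reach_of_mem_PFChains hc i).2

theorem convexAbove_val (x : PosetPF n k) : ConvexAbove k x.val := x.convexReach_val.convexAbove

theorem le_iff_convexReach (hk : 1 ≤ k) {x y : PosetPF n k} :
    x ≤ y ↔ ConvexReach k x.val y.val := by
  constructor
  · exact Relation.ReflTransGen.mono (fun _ _ h => ((PFEdge_iff hk).1 h).2.1) _ _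
  · have key : ∀ z, ConvexReach k x.val z → ConvexReach k z (indiscreteNC _) →
        Relation.ReflTransGen (PFEdge n k) x.val z := by
      intro z h
      induction h with
      | refl => exact fun _ => .refl
      | tail h1 h2 ih =>
        exact fun h3 => (ih (h3.head h2)).tail
          (PFEdge_of_convexEdge hk (x.convexReach_val.trans h1) h2 h3)
    exact fun h => key _ h y.val_convexReach

/-- The order of `Poset(PF_{n,k})` is the product of the order by paths on the restrictions to
`[0, k]` and the inclusion order on the sets of nonminimal elements beyond `k`. -/
theorem le_iff (hkn : k ≤ n) {p : Fin (n + 1)} (hp : (p : ℕ) + 1 = k) {x y : PosetPF n k} :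
    x ≤ y ↔ Reach p (restrictTo k x.val) (restrictTo k y.val) ∧
      nonminAbove k x.val ⊆ nonminAbove k y.val := by
  rw [le_iff_convexReach (by omega)]
  refine ⟨fun h => ⟨h.reach_restrictTo hp (by omega), nonminAbove_mono h.le⟩, fun h => ?_⟩
  exact convexReach_of_restrictTo hp x.convexAbove_val y.convexAbove_val h.1 h.2

end PosetPF

theorem theoremB (n k : ℕ) (hk : 1 < k) (hkn : k ≤ n) (x y : PosetPF n k) (hxy : x ≤ y) :
    Nonempty (Set.Icc x y ≃o (Set.Icc x y)ᵒᵈ) := by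
  let p : Fin (n + 1) := ⟨k - 1, by omega⟩
  let q : Fin (n + 1) := ⟨k, by omega⟩
  have hp : (p : ℕ) + 1 = k := by simp only [p]; omega
  obtain ⟨f, hf⟩ := exists_dual (restrictTo k x.val) (restrictTo k y.val) (p := p) (q := q)
    (by rw [hp]) (supportedOn_restrictTo y.val)
  have hle := fun {u v : PosetPF n k} => PosetPF.le_iff hkn hp (x := u) (y := v)
  have hfz : ∀ z ∈ Set.Icc x y, _ := fun z hz => hf (restrictTo k z.val) (hle.1 hz.1).1 (hle.1 hz.2).1
  set J : PosetPF n k → Set (Fin (n + 1)) := fun z => nonminAbove k z.val with hJ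
  -- the dual of an element restricts to the dual partition and has the complementary nonminimal
  -- elements
  have hex : ∀ z ∈ Set.Icc x y, ∃ z' : PosetPF n k, z' ∈ Set.Icc x y ∧
      restrictTo k z'.val = f (restrictTo k z.val) ∧ J z' = J x ∪ (J y \ J z) := by
    intro z hz
    obtain ⟨h1, h2, -, -⟩ := hfz z hz
    have hS : ∀ i ∈ J x ∪ (J y \ J z), k < (i : ℕ) := by
      rintro i (hi | hi)
      · exact hi.1
      · exact hi.1.1
    have hw := (supportedOn_restrictTo y.val).anti h2.le
    have h3 := restrictTo_attach hw hS
    have h4 := nonminAbove_attach hw hS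
    have h5 := convexAbove_attach hw hS
    set v := attach (f (restrictTo k z.val)) (J x ∪ (J y \ J z)) with hv
    have hxv : ConvexReach k x.val v := convexReach_of_restrictTo hp x.convexAbove_val h5
      (by rwa [h3]) (by rw [h4]; exact Set.subset_union_left)
    have hvy : ConvexReach k v y.val := convexReach_of_restrictTo hp h5 y.convexAbove_val
      (by rwa [h3]) (by
        rw [h4]
        exact Set.union_subset (hle.1 hxy).2 Set.sdiff_subset)
    refine ⟨⟨v, exists_mem_PFChains (by omega) (by omega) (x.convexReach_val.trans hxv)
      (hvy.trans y.val_convexReach)⟩, ⟨?_, ?_⟩, h3, h4⟩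
    · exact (PosetPF.le_iff_convexReach (by omega)).2 hxv
    · exact (PosetPF.le_iff_convexReach (by omega)).2 hvy
  choose g hg hgf hgJ using hex
  let F : Set.Icc x y → Set.Icc x y := fun z => ⟨g z z.2, hg z z.2⟩
  have hF : ∀ z z' : Set.Icc x y, z ≤ z' → F z' ≤ F z := by
    intro z z' h
    have h1 := hle.1 h
    refine hle.2 ⟨?_, ?_⟩
    · show Reach p (restrictTo k (g z' z'.2).val) (restrictTo k (g z z.2).val)
      rw [hgf, hgf]
      exact (hfz z z.2).2.2.2 _ h1.1 (hle.1 z'.2.2).1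
    · show J (g z' z'.2) ⊆ J (g z z.2)
      rw [hgJ, hgJ]
      exact Set.union_subset_union_right _ (Set.sdiff_subset_sdiff_right h1.2)
  have hFF : Function.Involutive F := by
    intro z
    have h1 : restrictTo k (F (F z)).1.val = restrictTo k z.1.val := by
      show restrictTo k (g (g z z.2) _).val = _
      rw [hgf, hgf]
      exact (hfz z z.2).2.2.1
    have h2 : J (F (F z)).1 = J z := by
      show J (g (g z z.2) _) = _
      rw [hgJ, hgJ]
      have h3 : J x ⊆ J z := (hle.1 z.2.1).2
      have h4 : J z ⊆ J y := (hle.1 z.2.2).2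
      ext i
      have := @h3 i
      have := @h4 i
      simp only [Set.mem_union, Set.mem_sdiff]
      tauto
    refine le_antisymm (hle.2 ⟨?_, h2.subset⟩) (hle.2 ⟨?_, h2.symm.subset⟩)
    · rw [h1]
      exact .refl
    · rw [h1]
      exact .refl
  refine ⟨⟨hFF.toPerm.trans OrderDual.toDual, fun {z z'} => ?_⟩⟩
  show F z' ≤ F z ↔ z ≤ z'
  refine ⟨fun h => ?_, hF z z'⟩
  have := hF _ _ h
  rwa [hFF, hFF] at this
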